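/- Let $p$ be a prime and $F$ a field of characteristic $p$. **Notation.** Let $\Omega^1(F)$ be the $F$-vector space spanned by symbols $da$ ($a\in F$) subject to additivity and the Leibniz rule, and $\Omega^n(F)=\bigwedge^n_F\Omega^1(F)$ for $n\ge 0$. Let $d\Omega^{n-1}(F)\subseteq\Omega^n(F)$ be the group of exact forms (zero for $n=0$), and let $\nu_n(F)$ be the kernel of the additive map $\wp:\Omega^n(F)\to\Omega^n(F)/d\Omega^{n-1}(F)$ with $x\frac{da_1}{a_1}\wedge\dots\wedge\frac{da_n}{a_n}\mapsto(x^p-x)\frac{da_1}{a_1}\wedge\dots\wedge\frac{da_n}{a_n}$. For a field extension $K/F$ let $\Omega^n(K/F)=\ker(\Omega^n(F)\to\Omega^n(K))$ and $\nu_n(K/F)=\nu_n(F)\cap\Omega^n(K/F)$. For $U\subseteq\Omega^s(F)$ put $\mathrm{ann}\Omega^n_F(U)=\{\omega\in\Omega^n(F)\mid \omega\wedge u=0\ \forall u\in U\}$ and $\mathrm{ann}\nu^n_F(U)=\nu_n(F)\cap\mathrm{ann}\Omega^n_F(U)$. For sets $S_1,\dots,S_s\subseteq F$ put $dS_1\wedge\dots\wedge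 dS_s=\{dx_1\wedge\dots\wedge dx_s\mid x_i\in S_i\}$ (for $s=0$ this is $\{1\}\subseteq\Omega^0(F)=F$). For a $p$-form $\varphi=\langle b_1,\dots,b_m\rangle_p$ over $F$, i.e. $\varphi(v)=\sum_i b_iv_i^p$, let $D_F(\varphi)$ be the set of its nonzero values, $N_F(\varphi)=F^p(x/y\mid x,y\in D_F(\varphi))$ its norm field and $\mathrm{ndeg}_F(\varphi)=[N_F(\varphi):F^p]$. The function field $F(\varphi)$ is the fraction field of $F[X_1,\dots,X_m]/(\varphi(X_1,\dots,X_m))$ if $\mathrm{ndeg}_F(\varphi)>1$, and $F(X_1,\dots,X_m)$ if $\mathrm{ndeg}_F(\varphi)=1$. For $p$-forms $\varphi_1,\dots,\varphi_r$ over $F$ let $F(\varphi_1,\dots,\varphi_r)=F_r$, where $F_0=F$ and $F_i=F_{i-1}(\varphi_i)$, with $\varphi_i$ regarded as a form over $F_{i-1}$. **Setting.** For $i=1,\dots,r$ let $\varphi_i=\langle 1,a_{i1},\dots,a_{in_i}\rangle_p$ with $n_i\ge 0$ and $a_{ij}\in F$. Let $\mathrm{ndeg}_F(\varphi_i)=p^{k_i}$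 with the $a_{ij}$ ordered such that $k_i\le n_i$ and $N_F(\varphi_i)=F^p(a_{i1},\dots,a_{ik_i})$. Put $M=F(X_{ij}\mid 1\le i\le r,\ 1\le j\le n_i)$ and $T_i=\sum_{j=1}^{n_i}a_{ij}X_{ij}^p$, and suppose that $\varphi_1,\dots,\varphi_r$ are ordered such that, for some $s\le r$, $M(\sqrt[p]{T_1},\dots,\sqrt[p]{T_r})=M(\sqrt[p]{T_1},\dots,\sqrt[p]{T_s})$ and this field has degree $p^s$ over $M$. **Theorem.** Let $A=d\{a_{11},\dots,a_{1k_1}\}\wedge\dots\wedge d\{a_{s1},\dots,a_{sk_s}\}$ and $N=dN_F(\varphi_1)\wedge\dots\wedge dN_F(\varphi_s)$. Both $A$ and $N$ contain a nonzero element, and for every $n\ge 0$ $$\Omega^n(F(\varphi_1,\dots,\varphi_r)/F)=\Omega^n(F(\varphi_1,\dots,\varphi_s)/F)=\mathrm{ann}\Omega^n_F(A)=\mathrm{ann}\Omega^n_F(N),$$ $$\nu_n(F(\varphi_1,\dots,\varphi_r)/F)=\nu_n(F(\varphi_1,\dots,\varphi_s)/F)=\mathrm{ann}\nu^n_F(A)=\mathrm{ann}\nu^n_F(N).$$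 In particular both kernels depend only on $N_F(\varphi_1),\dots,N_F(\varphi_s)$: if $\psi_1,\dots,\psi_{r'}$ ($r'\ge s$) are further forms $\langle 1,b_{i1},\dots,b_{im_i}\rangle_p$ over $F$, ordered in the same sense with the same number $s$, and $N_F(\psi_i)=N_F(\varphi_i)$ for $i\le s$, then for every $n\ge 0$ one has $\Omega^n(F(\psi_1,\dots,\psi_{r'})/F)=\Omega^n(F(\varphi_1,\dots,\varphi_r)/F)$ and $\nu_n(F(\psi_1,\dots,\psi_{r'})/F)=\nu_n(F(\varphi_1,\dots,\varphi_r)/F)$. -/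

import Mathlib

open scoped KaehlerDifferential

universe u

noncomputable section

namespace PFormKernels

/-! ### Differential forms -/

/-- `Ω^n(F)`: the `n`-th exterior power over `F` of the `F`-space `Ω¹(F)` spanned by symbols `d a`
(`a ∈ F`) subject to additivity and the Leibniz rule. -/
abbrev DiffForm (n : ℕ) (F : Type u) [Field F] : Submodule F (ExteriorAlgebra F (Ω[F⁄ℤ])) :=
  ⋀[F]^n (Ω[F⁄ℤ])

/-- `d c₁ ∧ … ∧ d cₙ`. -/
def dWedge {F : Type u} [Field F] {n : ℕ} (c : Fin n → F) : DiffForm n F :=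
  exteriorPower.ιMulti F n fun i => KaehlerDifferential.D ℤ F (c i)

/-- The logarithmic form `d c₁ / c₁ ∧ … ∧ d cₙ / cₙ`. -/
def dLog {F : Type u} [Field F] {n : ℕ} (c : Fin n → Fˣ) : DiffForm n F :=
  exteriorPower.ιMulti F n fun i =>
    ((c i : F)⁻¹) • KaehlerDifferential.D ℤ F (c i : F)

/-- The exact forms `d Ω^{n-1}(F) ⊆ Ω^n(F)`. As `d` is the additive map with
`d (x d a₁ ∧ … ∧ d aₘ) = d x ∧ d a₁ ∧ … ∧ d aₘ` and these arguments generate `Ω^m(F)` additively,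
its image is generated by the values `d x ∧ d a₁ ∧ … ∧ d aₘ`. For `n = 0` it is zero. -/
def exactForms (F : Type u) [Field F] : (n : ℕ) → AddSubgroup (DiffForm n F)
  | 0 => ⊥
  | m + 1 => AddSubgroup.closure
      {ω | ∃ (x : F) (a : Fin m → F), ω = dWedge (Fin.cons x a : Fin (m + 1) → F)}

/-- The graph of the Artin–Schreier map `℘ : Ω^n(F) → Ω^n(F) / d Ω^{n-1}(F)`, the additive map
with `℘ (x • dlog a) = (x ^ p - x) • dlog a mod d Ω^{n-1}(F)`: the additive group generated by
these pairs (the forms `x • dlog a` generate `Ω^n(F)` additively). -/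
def wpGraph (p n : ℕ) (F : Type u) [Field F] :
    AddSubgroup (DiffForm n F × (DiffForm n F ⧸ exactForms F n)) :=
  AddSubgroup.closure
    {z | ∃ (x : F) (a : Fin n → Fˣ),
      z = (x • dLog a, QuotientAddGroup.mk ((x ^ p - x) • dLog a))}

/-- `ν_n(F) = ker ℘`, i.e. the forms `ω` such that `(ω, 0)` lies on the graph of `℘`. -/
def nu (p n : ℕ) (F : Type u) [Field F] : AddSubgroup (DiffForm n F) :=
  (wpGraph p n F).comap (AddMonoidHom.inl (DiffForm n F) (DiffForm n F ⧸ exactForms F n))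

/-- The restriction map `Ω^n(F) → Ω^n(K)`, `ω ↦ ω_K`, of a field extension `K / F`; it sends
`x d a₁ ∧ … ∧ d aₙ` to the form given by the same expression over `K`. -/
def restr (n : ℕ) (F K : Type u) [Field F] [Field K] [Algebra F K] :
    DiffForm n F →ₗ[F] DiffForm n K :=
  exteriorPower.alternatingMapLinearEquiv
    { toFun := fun v => exteriorPower.ιMulti K n fun i => KaehlerDifferential.map ℤ ℤ F K (v i)
      map_update_add' := fun {_} v i x y => by
        have h : ∀ z, (fun j => KaehlerDifferential.map ℤ ℤ F K (Function.update v i z j)) =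
            Function.update (fun j => KaehlerDifferential.map ℤ ℤ F K (v j)) i
              (KaehlerDifferential.map ℤ ℤ F K z) := fun z => by
          funext j
          exact Function.apply_update (fun _ => KaehlerDifferential.map ℤ ℤ F K) v i z j
        simp only [h, map_add, AlternatingMap.map_update_add]
      map_update_smul' := fun {_} v i c x => by
        have h : ∀ z, (fun j => KaehlerDifferential.map ℤ ℤ F K (Function.update v i z j)) =
            Function.update (fun j => KaehlerDifferential.map ℤ ℤ F K (v j)) i
              (KaehlerDifferential.map ℤ ℤ F K z) := fun z => by
          funext j
          exact Function.apply_update (fun _ => KaehlerDifferential.map ℤ ℤ F K) v i z j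
        simp only [h, map_smul]
        rw [← algebraMap_smul K c, AlternatingMap.map_update_smul, algebraMap_smul]
      map_eq_zero_of_eq' := fun v i j hv hij =>
        AlternatingMap.map_eq_zero_of_eq _ _ (by simp only [hv]) hij }

theorem restr_dWedge {n : ℕ} {F K : Type u} [Field F] [Field K] [Algebra F K] (c : Fin n → F) :
    restr n F K (dWedge c) = dWedge fun i => algebraMap F K (c i) := by
  simp only [restr, dWedge, exteriorPower.alternatingMapLinearEquiv_apply_ιMulti]
  change exteriorPower.ιMulti K n _ = _
  simp only [KaehlerDifferential.map_D]

/-- The `Ω`-kernel `Ω^n(K/F)`. -/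
def omegaKernel (n : ℕ) (F K : Type u) [Field F] [Field K] [Algebra F K] : Set (DiffForm n F) :=
  {ω | restr n F K ω = 0}

/-- The `ν`-kernel `ν_n(K/F)`. -/
def nuKernel (p n : ℕ) (F K : Type u) [Field F] [Field K] [Algebra F K] : Set (DiffForm n F) :=
  {χ | χ ∈ nu p n F ∧ restr n F K χ = 0}

/-- `d S₁ ∧ … ∧ d Sₛ`, the set of all `d x₁ ∧ … ∧ d xₛ` with `xᵢ ∈ Sᵢ`. -/
def dWedgeSet {F : Type u} [Field F] {s : ℕ} (S : Fin s → Set F) : Set (DiffForm s F) :=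
  {ω | ∃ x : Fin s → F, (∀ i, x i ∈ S i) ∧ ω = dWedge x}

/-- The `Ω`-annihilator of `U ⊆ Ω^s(F)` in degree `n`; the wedge product is the product of the
exterior algebra. -/
def annOmega (n : ℕ) {F : Type u} [Field F] {s : ℕ} (U : Set (DiffForm s F)) :
    Set (DiffForm n F) :=
  {ω | ∀ η ∈ U, (ω : ExteriorAlgebra F (Ω[F⁄ℤ])) * (η : ExteriorAlgebra F (Ω[F⁄ℤ])) = 0}

/-- The `ν`-annihilator of `U ⊆ Ω^s(F)` in degree `n`. -/
def annNu (p n : ℕ) {F : Type u} [Field F] {s : ℕ} (U : Set (DiffForm s F)) :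
    Set (DiffForm n F) :=
  {χ | χ ∈ nu p n F ∧
    ∀ η ∈ U, (χ : ExteriorAlgebra F (Ω[F⁄ℤ])) * (η : ExteriorAlgebra F (Ω[F⁄ℤ])) = 0}

/-! ### `p`-forms, norm fields and function fields -/

/-- The subfield `F^p` of `p`-th powers. -/
abbrev powField (p : ℕ) (F : Type u) [Field F] [Fact p.Prime] [CharP F p] : Subfield F :=
  (frobenius F p).fieldRange

/-- `F^p(S)`. -/
abbrev powAdjoin (p : ℕ) {F : Type u} [Field F] [Fact p.Prime] [CharP F p] (S : Set F) :
    IntermediateField (powField p F) F :=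
  IntermediateField.adjoin (powField p F) S

/-- The `p`-form `⟨b₁, …, bₘ⟩_p`, given by its coefficients; its polynomial is `∑ bᵢ Xᵢ ^ p`. -/
structure PForm (F : Type u) where
  /-- the dimension -/
  dim : ℕ
  /-- the coefficients -/
  coeff : Fin dim → F

namespace PForm

variable {F : Type u} [Field F]

/-- The `p`-form `⟨1, a₁, …, aₙ⟩_p`. -/
def oneCons {n : ℕ} (a : Fin n → F) : PForm F := ⟨n + 1, Fin.cons 1 a⟩

/-- The form with scalars extended to `K`. -/
def baseChange (φ : PForm F) (K : Type u) [Field K] [Algebra F K] : PForm K :=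
  ⟨φ.dim, fun i => algebraMap F K (φ.coeff i)⟩

/-- The value of the form at a vector. -/
def eval (p : ℕ) (φ : PForm F) (v : Fin φ.dim → F) : F := ∑ i, φ.coeff i * v i ^ p

/-- `D_F(φ)`, the set of non-zero elements represented by the form. -/
def values (p : ℕ) (φ : PForm F) : Set F := {x | x ≠ 0 ∧ ∃ v, φ.eval p v = x}

/-- The polynomial `∑ bᵢ Xᵢ ^ p`. -/
def poly (p : ℕ) (φ : PForm F) : MvPolynomial (Fin φ.dim) F :=
  ∑ i, MvPolynomial.C (φ.coeff i) * MvPolynomial.X i ^ p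

/-- The norm field `N_F(φ) = F^p(x / y | x, y ∈ D_F(φ))`. -/
def normField (p : ℕ) [Fact p.Prime] [CharP F p] (φ : PForm F) :
    IntermediateField (powField p F) F :=
  powAdjoin p {z | ∃ x ∈ φ.values p, ∃ y ∈ φ.values p, z = x / y}

/-- The norm degree `[N_F(φ) : F^p]`. -/
def normDegree (p : ℕ) [Fact p.Prime] [CharP F p] (φ : PForm F) : ℕ :=
  Module.finrank (powField p F) (φ.normField p)

open Classical in
/-- The function field of `φ` is the fraction field of `F[X] / I`, where `I` is the ideal generated
by the polynomial of `φ` if the norm degree exceeds `1`, and `0` otherwise. -/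
def functionFieldIdeal (p : ℕ) [Fact p.Prime] [CharP F p] (φ : PForm F) :
    Ideal (MvPolynomial (Fin φ.dim) F) :=
  if 1 < φ.normDegree p then Ideal.span {φ.poly p} else ⊥

theorem exists_of_one_lt_normDegree (p : ℕ) [Fact p.Prime] [CharP F p] (φ : PForm F)
    (h : 1 < φ.normDegree p) :
    ∃ i, φ.coeff i ≠ 0 ∧ ∃ j, ∀ c : F, c ^ p ≠ φ.coeff j / φ.coeff i := by
  by_contra! hcon
  have hbot : φ.normField p = ⊥ := by
    rw [normField, powAdjoin, IntermediateField.adjoin_eq_bot_iff]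
    rintro _ ⟨x, ⟨hx, v, rfl⟩, y, ⟨hy, w, rfl⟩, rfl⟩
    obtain ⟨i, hi⟩ : ∃ i, φ.coeff i ≠ 0 := by
      by_contra! h0
      exact hx (by simp [eval, h0])
    choose c hc using hcon i hi
    have key : ∀ v, φ.eval p v = φ.coeff i * (∑ j, c j * v j) ^ p := by
      intro v
      rw [sum_pow_char, Finset.mul_sum]
      refine Finset.sum_congr rfl fun j _ => ?_
      rw [mul_pow, hc]
      field_simp
    rw [SetLike.mem_coe, IntermediateField.mem_bot]
    refine ⟨⟨((∑ j, c j * v j) / (∑ j, c j * w j)) ^ p, ⟨_, rfl⟩⟩, ?_⟩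
    change ((∑ j, c j * v j) / (∑ j, c j * w j)) ^ p = _
    rw [key, key, mul_div_mul_left _ _ hi, div_pow]
  rw [normDegree, hbot, IntermediateField.finrank_bot] at h
  exact lt_irrefl _ h

theorem prime_aux (p : ℕ) [hp : Fact p.Prime] [CharP F p] {σ : Type} [Fintype σ]
    (c : σ → F) (j : σ) (hj : ∀ x : F, x ^ p ≠ c j) :
    Prime (Polynomial.X ^ p + Polynomial.C (∑ k, MvPolynomial.C (c k) * MvPolynomial.X k ^ p) :
      Polynomial (MvPolynomial σ F)) := by
  classical
  have hroot : ∀ q : MvPolynomial σ F,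
      q ^ p ≠ -∑ k, MvPolynomial.C (c k) * MvPolynomial.X k ^ p := by
    intro q hq
    have h1 := congrArg (MvPolynomial.eval (Pi.single j (1 : F))) hq
    rw [map_pow, map_neg, map_sum, Finset.sum_eq_single j] at h1
    · refine hj (-(MvPolynomial.eval (Pi.single j (1 : F)) q)) ?_
      have h2 : (-1 : F) ^ p = -1 := by simp [← frobenius_def]
      rw [neg_pow, h1, h2]
      simp
    · intro k _ hk
      simp [Pi.single_eq_of_ne hk, hp.out.ne_zero]
    · simp
  rw [← sub_neg_eq_add, ← map_neg Polynomial.C]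
  generalize -∑ k, MvPolynomial.C (c k) * MvPolynomial.X k ^ p = t at hroot ⊢
  have hmonic := Polynomial.monic_X_pow_sub_C t hp.out.ne_zero
  refine Irreducible.prime ?_
  rw [hmonic.irreducible_iff_irreducible_map_fraction_map (K := FractionRing (MvPolynomial σ F)),
    Polynomial.map_sub, Polynomial.map_pow, Polynomial.map_X, Polynomial.map_C]
  refine X_pow_sub_C_irreducible_of_prime hp.out fun β hβ => ?_
  have hint : IsIntegral (MvPolynomial σ F) (β ^ p) := hβ ▸ isIntegral_algebraMap
  obtain ⟨q, rfl⟩ := IsIntegrallyClosed.exists_algebraMap_eq_of_isIntegral_pow hp.out.pos hint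
  rw [← map_pow] at hβ
  exact hroot q (IsFractionRing.injective (MvPolynomial σ F) _ hβ)

theorem prime_poly (p : ℕ) [hp : Fact p.Prime] [CharP F p] (φ : PForm F)
    (h : 1 < φ.normDegree p) : Prime (φ.poly p) := by
  classical
  obtain ⟨i, hi, j, hj⟩ := φ.exists_of_one_lt_normDegree p h
  have hji : j ≠ i := by
    rintro rfl
    exact hj 1 (by rw [one_pow, div_self hi])
  have haux := prime_aux p (fun k : {k // k ≠ i} => φ.coeff k / φ.coeff i) ⟨j, hji⟩ hj
  obtain ⟨e, he⟩ : ∃ e : MvPolynomial (Fin φ.dim) F ≃ₐ[F]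
      Polynomial (MvPolynomial {k : Fin φ.dim // k ≠ i} F),
      e = (MvPolynomial.renameEquiv F (Equiv.optionSubtypeNe i).symm).trans
        (MvPolynomial.optionEquivLeft F _) := ⟨_, rfl⟩
  have hC : ∀ x : F, e (MvPolynomial.C x) = Polynomial.C (MvPolynomial.C x) := fun x => by
    rw [he, AlgEquiv.trans_apply, MvPolynomial.renameEquiv_apply, MvPolynomial.rename_C,
      MvPolynomial.optionEquivLeft_C]
  have hXi : e (MvPolynomial.X i) = Polynomial.X := by
    rw [he, AlgEquiv.trans_apply, MvPolynomial.renameEquiv_apply, MvPolynomial.rename_X,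
      Equiv.optionSubtypeNe_symm_self, MvPolynomial.optionEquivLeft_X_none]
  have hX : ∀ k : {k : Fin φ.dim // k ≠ i},
      e (MvPolynomial.X (k : Fin φ.dim)) = Polynomial.C (MvPolynomial.X k) := fun k => by
    rw [he, AlgEquiv.trans_apply, MvPolynomial.renameEquiv_apply, MvPolynomial.rename_X,
      Equiv.optionSubtypeNe_symm_of_ne k.2, MvPolynomial.optionEquivLeft_X_some]
  have hsum : φ.poly p = MvPolynomial.C (φ.coeff i) * MvPolynomial.X i ^ p +
      ∑ k : {k : Fin φ.dim // k ≠ i},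
        MvPolynomial.C (φ.coeff k) * MvPolynomial.X (k : Fin φ.dim) ^ p := by
    rw [poly, ← Finset.add_sum_erase _ _ (Finset.mem_univ i)]
    congr 1
    exact (Finset.sum_subtype (p := fun k => k ≠ i) _ (by simp) _)
  have hpoly : e (φ.poly p) = Polynomial.C (MvPolynomial.C (φ.coeff i)) *
      (Polynomial.X ^ p + Polynomial.C (∑ k : {k : Fin φ.dim // k ≠ i},
        MvPolynomial.C (φ.coeff k / φ.coeff i) * MvPolynomial.X k ^ p)) := by
    rw [hsum, map_add, map_sum, mul_add, map_mul, map_pow, hC, hXi, ← Polynomial.C_mul,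
      Finset.mul_sum, map_sum]
    congr 1
    refine Finset.sum_congr rfl fun k _ => ?_
    rw [map_mul, map_pow, hC, hX, ← mul_assoc, ← MvPolynomial.C_mul, mul_div_cancel₀ _ hi,
      Polynomial.C_mul, Polynomial.C_pow]
  rw [← MulEquiv.prime_iff e.toMulEquiv]
  change Prime (e (φ.poly p))
  rw [hpoly]
  have hunit : IsUnit (Polynomial.C (MvPolynomial.C (φ.coeff i)) :
      Polynomial (MvPolynomial {k : Fin φ.dim // k ≠ i} F)) :=
    ((isUnit_iff_ne_zero.mpr hi).map MvPolynomial.C).map Polynomial.C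
  exact (associated_unit_mul_right _ _ hunit).prime haux

instance functionFieldIdeal_isPrime (p : ℕ) [Fact p.Prime] [CharP F p] (φ : PForm F) :
    (φ.functionFieldIdeal p).IsPrime := by
  unfold functionFieldIdeal
  split_ifs with h
  · have hp := φ.prime_poly p h
    exact (Ideal.span_singleton_prime hp.ne_zero).mpr hp
  · exact Ideal.isPrime_bot

/-- The function field `F(φ)`: the fraction field of `F[X] / (φ(X))` if the norm degree of `φ`
exceeds `1`, and of `F[X]` otherwise. -/
abbrev FunctionField (p : ℕ) [Fact p.Prime] [CharP F p] (φ : PForm F) : Type u :=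
  FractionRing (MvPolynomial (Fin φ.dim) F ⧸ φ.functionFieldIdeal p)

end PForm

/-- A field extension of `F`, bundled. -/
structure FieldExt (p : ℕ) (F : Type u) [Field F] where
  /-- the extension field -/
  carrier : Type u
  [field : Field carrier]
  [algebra : Algebra F carrier]
  [charP : CharP carrier p]

attribute [instance] FieldExt.field FieldExt.algebra FieldExt.charP

/-- The extension `K(φ)` of `F`, where `K / F` is an extension and `φ` is a `p`-form over `F`. -/
def FieldExt.step {p : ℕ} [Fact p.Prime] {F : Type u} [Field F] (K : FieldExt p F)
    (φ : PForm F) : FieldExt p F :=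
  { carrier := (φ.baseChange K.carrier).FunctionField p
    charP := charP_of_injective_algebraMap
      (algebraMap K.carrier ((φ.baseChange K.carrier).FunctionField p)).injective p }

/-- The iterated function field `F(φ₁, …, φᵣ)`: `F_0 = F` and `F_i = F_{i-1}(φ_i)`. -/
def iterFunctionField (p : ℕ) [Fact p.Prime] {F : Type u} [Field F] [CharP F p] :
    (r : ℕ) → (Fin r → PForm F) → FieldExt p F
  | 0, _ => { carrier := F }
  | r + 1, φ => (iterFunctionField p r fun i => φ i.castSucc).step (φ (Fin.last r))

/-! ### The standing normalization -/

/-- The rational function field `M = F(X_{ij} | i = 1, …, r, j = 1, …, n_i)`. -/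
abbrev VarField (F : Type u) [Field F] {r : ℕ} (n : Fin r → ℕ) : Type u :=
  FractionRing (MvPolynomial (Σ i, Fin (n i)) F)

/-- `T_i = ∑ⱼ a_{ij} X_{ij} ^ p ∈ M`. -/
def T (p : ℕ) {F : Type u} [Field F] {r : ℕ} {n : Fin r → ℕ} (a : ∀ i, Fin (n i) → F)
    (i : Fin r) : VarField F n :=
  algebraMap (MvPolynomial (Σ i, Fin (n i)) F) (VarField F n)
    (∑ j, MvPolynomial.C (a i j) * MvPolynomial.X ⟨i, j⟩ ^ p)

/-- The subfield of an algebraic closure of `M` generated over `M` by the `p`-th roots of the `T_i`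
with `i ∈ I`. -/
def rootField (p : ℕ) {F : Type u} [Field F] {r : ℕ} {n : Fin r → ℕ} (a : ∀ i, Fin (n i) → F)
    (I : Set (Fin r)) : IntermediateField (VarField F n) (AlgebraicClosure (VarField F n)) :=
  IntermediateField.adjoin (VarField F n) {y | ∃ i ∈ I, y ^ p = algebraMap _ _ (T p a i)}

/-- The forms `⟨1, a_{i1}, …, a_{i n_i}⟩_p` (`i = 1, …, r`) are ordered such that the first `s` of
the `T_i` give everything: `M(T_1^{1/p}, …, T_r^{1/p}) = M(T_1^{1/p}, …, T_s^{1/p})`, and this field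
has degree `p ^ s` over `M`. -/
def IsFormOrdering (p : ℕ) {F : Type u} [Field F] {r : ℕ} {n : Fin r → ℕ}
    (a : ∀ i, Fin (n i) → F) (s : ℕ) : Prop :=
  Module.finrank (VarField F n) (rootField p a Set.univ) = p ^ s ∧
  rootField p a Set.univ = rootField p a {i | (i : ℕ) < s}

/-- The coefficients of `φ = ⟨1, a₁, …, aₙ⟩_p` are ordered such that, with `p ^ k` the norm degree
of `φ`, the norm field of `φ` is `F^p(a₁, …, aₖ)`. -/
def IsCoeffOrdering (p : ℕ) {F : Type u} [Field F] [Fact p.Prime] [CharP F p] {n : ℕ}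
    (a : Fin n → F) (k : ℕ) : Prop :=
  k ≤ n ∧
  (PForm.oneCons a).normDegree p = p ^ k ∧
  (PForm.oneCons a).normField p = powAdjoin p {x | ∃ j : Fin n, (j : ℕ) < k ∧ x = a j}

end PFormKernels

end

/-! One function field at a time. Let φ = ⟨c_0, …, c_m⟩ over K have a coefficient equal to 1 and
norm degree greater than 1, and let x_i be the generic zero in L = K(φ). Differentiating ∑ c_i x_i^p
= 0 gives ∑ x_i^p dc_i = 0, and this is the only new relation: θ = ∑ x_i^p ⊗ dc_i spans the kernel
of L ⊗ Ω¹(K) → Ω¹(L) (`PForm.ker_mapBaseChange_functionField`), since every functional killing θ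
comes from a derivation of L. Hence a form ω over K dies over L iff θ ∧ ω = 0
(`map_eq_zero_iff_of_ker_eq_span`). The x_i^p away from the coefficient 1 are linearly independent
over K, so this means dc_i ∧ ω = 0 for all i. If the norm degree is not greater than 1, restriction
is injective.

Iterating, ω dies over F_{i+1} iff all dc ∧ ω, c a coefficient of the next form, die over F_i. So
the kernel for s forms is the annihilator of all wedges of one coefficient differential per form,
provided some such wedge is nonzero. If all wedges with one further coefficient vanish, later forms
change nothing (`formRes_iterFunctionField_eq_zero_iff_of_le`).

Both provisos come from the generic values T_i, where dT_i = ∑ X_{ij}^p da_{ij}. Degree p^s makes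
dT_1, …, dT_s independent (`linearIndependent_D_of_finrank_rootsField`), and expanding their wedge
yields a nonzero wedge of da's. Conversely, independent da's from distinct forms make the dT's
independent (`linearIndependent_D_genericValue`), whereas a p-th root of T_i lying in the field of
the first s roots puts dT_i in the span of dT_1, …, dT_s (`D_mem_span_of_mem_rootsField`).

Finally, these annihilators depend only on the spans of the differentials, and dF^p(S) lies in the
span of dS (`DiffSubset.of_mem_adjoin`); so coefficients, selected coefficients and norm fields give
the same annihilator. The ν-statements follow by intersecting with ν_n(F). -/

noncomputable section

namespace PFormKernels

open scoped TensorProduct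

/-! ### Annihilators of vectors in exterior algebras -/

section ExteriorAlgebra

open ExteriorAlgebra

variable {L U W : Type*} [Field L] [AddCommGroup U] [Module L U] [AddCommGroup W] [Module L W]

/-- Contraction is an antiderivation: contracting θ ∧ x by `d` gives x − θ ∧ (d ⌋ x). So the
annihilator of θ is the ideal generated by θ. -/
theorem ι_mul_contractLeft_of_mul_eq_zero {θ : U} {d : Module.Dual L U} (hd : d θ = 1)
    {x : ExteriorAlgebra L U} (h : ι L θ * x = 0) :
    x = ι L θ * CliffordAlgebra.contractLeft d x := by
  have := CliffordAlgebra.contractLeft_ι_mul (Q := 0) (d := d) θ x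
  change CliffordAlgebra.contractLeft d (ι L θ * x) = _ at this
  rw [h, map_zero, hd, one_smul] at this
  exact sub_eq_zero.mp this.symm

theorem contractRight_mul_ι_of_mul_eq_zero {θ : U} {d : Module.Dual L U} (hd : d θ = 1)
    {x : ExteriorAlgebra L U} (h : x * ι L θ = 0) :
    x = CliffordAlgebra.contractRight x d * ι L θ := by
  have := CliffordAlgebra.contractRight_mul_ι (Q := 0) (d := d) θ x
  change CliffordAlgebra.contractRight (x * ι L θ) d = _ at this
  rw [h, map_zero, LinearMap.zero_apply, hd, one_smul] at this
  exact sub_eq_zero.mp this.symm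

theorem ι_mul_ι_comm (a b : U) : ι L a * ι L b = -(ι L b * ι L a) :=
  eq_neg_of_add_eq_zero_left (ι_add_mul_swap a b)

theorem ι_mul_mul_ι (θ : U) (x : ExteriorAlgebra L U) : ι L θ * x * ι L θ = 0 := by
  refine CliffordAlgebra.left_induction (Q := (0 : QuadraticForm L U))
    (P := fun x => ι L θ * x * ι L θ = 0) ?_ ?_ ?_ x
  · intro r
    change ι L θ * algebraMap L (ExteriorAlgebra L U) r * ι L θ = 0
    rw [← Algebra.commutes, mul_assoc, ι_sq_zero, mul_zero]
  · intro x y hx hy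
    rw [mul_add, add_mul, hx, hy, add_zero]
  · intro x m hx
    change ι L θ * (ι L m * x) * ι L θ = 0
    rw [← mul_assoc, ι_mul_ι_comm, neg_mul, neg_mul, mul_assoc, mul_assoc, ← mul_assoc (ι L θ), hx,
      mul_zero, neg_zero]

theorem ι_mul_eq_zero_comm (θ : U) (x : ExteriorAlgebra L U) :
    ι L θ * x = 0 ↔ x * ι L θ = 0 := by
  rcases eq_or_ne θ 0 with rfl | hθ
  · simp
  obtain ⟨d, hd⟩ := Module.Projective.exists_dual_eq_one L hθ
  constructor <;> intro h
  · rw [ι_mul_contractLeft_of_mul_eq_zero hd h, ι_mul_mul_ι]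
  · rw [contractRight_mul_ι_of_mul_eq_zero hd h, ← mul_assoc, ι_mul_mul_ι]

theorem list_prod_mul_eq_zero_comm (l : List U) (x : ExteriorAlgebra L U) :
    (l.map (ι L)).prod * x = 0 ↔ x * (l.map (ι L)).prod = 0 := by
  induction l generalizing x with
  | nil => simp
  | cons v l ih =>
    rw [List.map_cons, List.prod_cons, mul_assoc, ι_mul_eq_zero_comm, mul_assoc, ih, mul_assoc]

/-- Allows the inductions to multiply on the left while the annihilators in the statement multiply
on the right, for inhomogeneous `x` as well and without tracking signs. -/
theorem ιMulti_mul_eq_zero_comm {n : ℕ} (v : Fin n → U) (x : ExteriorAlgebra L U) :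
    ιMulti L n v * x = 0 ↔ x * ιMulti L n v = 0 := by
  have h : List.ofFn (fun i => ι L (v i)) = (List.ofFn v).map (ι L) := by
    rw [List.map_ofFn]; rfl
  rw [ιMulti_apply, h, list_prod_mul_eq_zero_comm]

theorem ιMulti_snoc {n : ℕ} (v : Fin (n + 1) → U) :
    ιMulti L (n + 1) v = ιMulti L n (fun i => v i.castSucc) * ι L (v (Fin.last n)) := by
  rw [ιMulti_apply, ιMulti_apply, List.ofFn_succ', List.concat_eq_append, List.prod_append,
    List.prod_singleton]

/-- If the kernel of `π` is spanned by `θ ≠ 0`, the kernel of `⋀ π` is the annihilator of `θ`. -/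
theorem map_eq_zero_iff_of_ker_eq_span {π : U →ₗ[L] W} {θ : U} (hθ : θ ≠ 0)
    (hπ : LinearMap.ker π = L ∙ θ) (x : ExteriorAlgebra L U) :
    ExteriorAlgebra.map π x = 0 ↔ ι L θ * x = 0 := by
  obtain ⟨d, hd⟩ := Module.Projective.exists_dual_eq_one L hθ
  have hπθ : π θ = 0 := by
    rw [← LinearMap.mem_ker, hπ]; exact Submodule.mem_span_singleton_self θ
  constructor
  · intro h
    -- The projection along θ onto the kernel of `d`. It kills θ, hence factors through π as σ ∘ π.
    let f : U →ₗ[L] U := LinearMap.id - d.smulRight θ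
    have hf : LinearMap.ker π ≤ LinearMap.ker f := by
      rw [hπ, Submodule.span_singleton_le_iff_mem, LinearMap.mem_ker]
      simp [f, hd]
    obtain ⟨σ, hσ⟩ := LinearMap.exists_extend
      ((Submodule.liftQ _ f hf).comp π.quotKerEquivRange.symm.toLinearMap)
    have hσπ : σ.comp π = f := by
      ext u
      have := LinearMap.congr_fun hσ ⟨π u, LinearMap.mem_range_self π u⟩
      simp only [LinearMap.comp_apply, Submodule.subtype_apply] at this
      rw [LinearMap.comp_apply, this]
      have h2 : π.quotKerEquivRange.symm ⟨π u, LinearMap.mem_range_self π u⟩ =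
          Submodule.Quotient.mk u := by
        rw [LinearEquiv.symm_apply_eq]; rfl
      change Submodule.liftQ _ f hf (π.quotKerEquivRange.symm _) = _
      rw [h2, Submodule.liftQ_apply]
    -- Modulo θ, `f` is the identity. The extra factor `y` lets the induction pass through products.
    have key : ∀ x y : ExteriorAlgebra L U,
        ι L θ * y * ExteriorAlgebra.map f x = ι L θ * y * x := by
      intro x
      induction x using ExteriorAlgebra.induction with
      | algebraMap r => intro y; rw [AlgHom.commutes]
      | ι u =>
        intro y
        rw [map_apply_ι]
        simp only [f, LinearMap.sub_apply, LinearMap.id_apply, LinearMap.smulRight_apply, map_sub,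
          map_smul, mul_sub, mul_smul_comm, ι_mul_mul_ι, smul_zero, sub_zero]
      | mul a b ha hb =>
        intro y
        rw [map_mul, ← mul_assoc, ha, mul_assoc (ι L θ), hb]
        simp only [mul_assoc]
      | add a b ha hb => intro y; rw [map_add, mul_add, mul_add, ha, hb]
    have h3 := key x 1
    rw [← hσπ, ← ExteriorAlgebra.map_comp_map, AlgHom.comp_apply, h, map_zero, mul_zero,
      mul_one] at h3
    exact h3.symm
  · intro h
    rw [ι_mul_contractLeft_of_mul_eq_zero hd h, map_mul, map_apply_ι, hπθ, map_zero, zero_mul]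

theorem ιMulti_ne_zero_of_linearIndependent {n : ℕ} {v : Fin n → U} (hv : LinearIndependent L v) :
    ιMulti L n v ≠ 0 := by
  have h := (exteriorPower.ιMulti_family_linearIndependent_field (n := n) hv).ne_zero
    (Set.powersetCard.ofFinEmbEquiv (RelEmbedding.refl _))
  rw [exteriorPower.ιMulti_family, Equiv.symm_apply_apply] at h
  exact fun h2 => h (Subtype.ext h2)

end ExteriorAlgebra

theorem multilinearMap_eq_zero_of_mem_span {ι R E G : Type*} [Fintype ι] [Field R]
    [AddCommGroup E] [Module R E] [AddCommGroup G] [Module R G]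
    (f : MultilinearMap R (fun _ : ι => E) G) (S : ι → Set E)
    (hf : ∀ v : ι → E, (∀ i, v i ∈ S i) → f v = 0) (v : ι → E)
    (hv : ∀ i, v i ∈ Submodule.span R (S i)) : f v = 0 := by
  classical
  -- Coordinates move from the generating sets to their spans one at a time; `t` records those
  -- already moved.
  have key : ∀ t : Finset ι, ∀ v : ι → E, (∀ i ∈ t, v i ∈ Submodule.span R (S i)) →
      (∀ i ∉ t, v i ∈ S i) → f v = 0 := by
    intro t
    induction t using Finset.induction_on with
    | empty => exact fun v _ h => hf v fun i => h i (by simp)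
    | insert a t ha ih =>
      intro v h1 h2
      have h3 : ∀ w ∈ Submodule.span R (S a), f (Function.update v a w) = 0 := by
        intro w hw
        induction hw using Submodule.span_induction with
        | mem w hw =>
          refine ih _ (fun i hi => ?_) fun i hi => ?_
          · rw [Function.update_of_ne (by rintro rfl; exact ha hi)]
            exact h1 i (Finset.mem_insert_of_mem hi)
          · rcases eq_or_ne i a with rfl | hia
            · simpa using hw
            · rw [Function.update_of_ne hia]
              exact h2 i (by simp [hia, hi])
        | zero => exact f.map_update_zero v a
        | add x y _ _ hx hy => rw [f.map_update_add, hx, hy, add_zero]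
        | smul c x _ hx => rw [f.map_update_smul, hx, smul_zero]
      simpa using h3 (v a) (h1 a (Finset.mem_insert_self _ _))
  exact key Finset.univ v (fun i _ => hv i) (fun i hi => absurd (Finset.mem_univ i) hi)

/-! ### Exterior algebras under extension of scalars -/

section BaseChange

open ExteriorAlgebra

variable (K L V : Type*) [Field K] [Field L] [Algebra K L] [AddCommGroup V] [Module K V]

theorem baseChange_ι_anticomm (x y : L ⊗[K] V) :
    (ι K (M := V)).baseChange L x * (ι K (M := V)).baseChange L y +
      (ι K (M := V)).baseChange L y * (ι K (M := V)).baseChange L x = 0 := by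
  induction x with
  | zero => simp
  | add x x' hx hx' =>
    rw [map_add, add_mul, mul_add, add_add_add_comm, hx, hx', add_zero]
  | tmul l v =>
    induction y with
    | zero => simp
    | add y y' hy hy' =>
      rw [map_add, add_mul, mul_add, add_add_add_comm, hy, hy', add_zero]
    | tmul m w =>
      simp only [LinearMap.baseChange_tmul, Algebra.TensorProduct.tmul_mul_tmul]
      rw [mul_comm m l, ← TensorProduct.tmul_add, ι_add_mul_swap, TensorProduct.tmul_zero]

theorem baseChange_ι_sq (x : L ⊗[K] V) :
    (ι K (M := V)).baseChange L x * (ι K (M := V)).baseChange L x = 0 := by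
  induction x with
  | zero => simp
  | add x y hx hy =>
    have := baseChange_ι_anticomm K L V x y
    rw [map_add, add_mul, mul_add, mul_add, hx, hy, zero_add, add_zero, this]
  | tmul l v =>
    simp only [LinearMap.baseChange_tmul, Algebra.TensorProduct.tmul_mul_tmul, ι_sq_zero,
      TensorProduct.tmul_zero]

/-- The canonical map `⋀_L (L ⊗ V) → L ⊗ ⋀_K V`. -/
def exteriorToBaseChange : ExteriorAlgebra L (L ⊗[K] V) →ₐ[L] L ⊗[K] ExteriorAlgebra K V :=
  ExteriorAlgebra.lift L ⟨(ι K (M := V)).baseChange L, baseChange_ι_sq K L V⟩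

variable {K V}

/-- The map `⋀_K V → ⋀_L W` induced by a `K`-linear map `V → W`. -/
def exteriorMap {W : Type*} [AddCommGroup W] [Module K W] [Module L W] [IsScalarTower K L W]
    (f : V →ₗ[K] W) : ExteriorAlgebra K V →ₐ[K] ExteriorAlgebra L W :=
  ExteriorAlgebra.lift K ⟨((ι L (M := W)).restrictScalars K).comp f, fun v => ι_sq_zero (f v)⟩

@[simp]
theorem exteriorMap_ι {W : Type*} [AddCommGroup W] [Module K W] [Module L W] [IsScalarTower K L W]
    (f : V →ₗ[K] W) (v : V) : exteriorMap L f (ι K v) = ι L (f v) :=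
  ExteriorAlgebra.lift_ι_apply _ _ _ _

theorem exteriorToBaseChange_exteriorMap (x : ExteriorAlgebra K V) :
    exteriorToBaseChange K L V (exteriorMap L (TensorProduct.mk K L V 1) x) = 1 ⊗ₜ x := by
  induction x using ExteriorAlgebra.induction with
  | algebraMap r =>
    rw [AlgHom.commutes, IsScalarTower.algebraMap_apply K L, AlgHom.commutes,
      ← IsScalarTower.algebraMap_apply K L, Algebra.TensorProduct.algebraMap_apply']
  | ι v =>
    rw [exteriorMap_ι, exteriorToBaseChange, lift_ι_apply]
    simp
  | mul a b ha hb =>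
    rw [map_mul, map_mul, ha, hb, Algebra.TensorProduct.tmul_mul_tmul, one_mul]
  | add a b ha hb => rw [map_add, map_add, ha, hb, TensorProduct.tmul_add]

/-- In L ⊗ ⋀V the relation reads ∑ y_i ⊗ w_i = 0. A K-functional on L that is dual to the
independent family `y` at `i` reads off w_i. -/
theorem eq_zero_of_sum_smul_exteriorMap_eq_zero {ι' : Type*} [Fintype ι'] {y : ι' → L}
    (hy : LinearIndependent K y) (w : ι' → ExteriorAlgebra K V)
    (h : ∑ i, y i • exteriorMap L (TensorProduct.mk K L V 1) (w i) = 0) (i : ι') : w i = 0 := by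
  have h1 := congrArg (exteriorToBaseChange K L V) h
  simp only [map_sum, map_smul, map_zero, exteriorToBaseChange_exteriorMap,
    TensorProduct.smul_tmul', smul_eq_mul, mul_one] at h1
  obtain ⟨g, hg⟩ := LinearMap.exists_extend ((Finsupp.lapply i).comp hy.repr)
  classical
  have hgy : ∀ j, g (y j) = if j = i then 1 else 0 := by
    intro j
    have h2 := LinearMap.congr_fun hg ⟨y j, Submodule.subset_span ⟨j, rfl⟩⟩
    rw [LinearMap.comp_apply, Submodule.subtype_apply] at h2
    rw [h2, LinearMap.comp_apply, hy.repr_eq_single j _ rfl, Finsupp.lapply_apply,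
      Finsupp.single_apply]
  have h3 := congrArg (fun z => TensorProduct.lid K _ (g.rTensor _ z)) h1
  simpa [hgy] using h3

theorem exteriorMap_mk_injective :
    Function.Injective (exteriorMap L (TensorProduct.mk K L V 1)) := by
  rw [injective_iff_map_eq_zero]
  intro x hx
  refine eq_zero_of_sum_smul_exteriorMap_eq_zero (L := L) (ι' := Unit) (y := fun _ => (1 : L))
    (LinearIndependent.of_subsingleton () one_ne_zero) (fun _ => x) ?_ ()
  simp [hx]

theorem exteriorMap_eq_map_comp {W : Type*} [AddCommGroup W] [Module K W] [Module L W]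
    [IsScalarTower K L W] (f : V →ₗ[K] W) (π : L ⊗[K] V →ₗ[L] W) (hπ : ∀ v, π (1 ⊗ₜ v) = f v)
    (x : ExteriorAlgebra K V) :
    exteriorMap L f x =
      ExteriorAlgebra.map π (exteriorMap L (TensorProduct.mk K L V 1) x) := by
  induction x using ExteriorAlgebra.induction with
  | algebraMap r =>
    rw [AlgHom.commutes, AlgHom.commutes, IsScalarTower.algebraMap_apply K L,
      IsScalarTower.algebraMap_apply K L (ExteriorAlgebra L (L ⊗[K] V)), AlgHom.commutes]
  | ι v =>
    rw [exteriorMap_ι, exteriorMap_ι, map_apply_ι, TensorProduct.mk_apply, hπ]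
  | mul a b ha hb => simp only [map_mul, ha, hb]
  | add a b ha hb => simp only [map_add, ha, hb]

end BaseChange

/-! ### Derivations, dual numbers and p-th powers -/

section Derivations

/-- A ring homomorphism `L → L[ε]` lifting the identity gives a derivation of `L`. -/
theorem exists_derivation_eq_snd {L : Type*} [Field L] (ψ : L →+* DualNumber L)
    (hψ : ∀ x, (ψ x).fst = x) : ∃ D : Derivation ℤ L L, ∀ x, D x = (ψ x).snd :=
  ⟨Derivation.mk'
    ((TrivSqZeroExt.sndHom L L).toAddMonoidHom.comp ψ.toAddMonoidHom).toIntLinearMap fun a b => by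
      change (ψ (a * b)).snd = a • (ψ b).snd + b • (ψ a).snd
      rw [map_mul, TrivSqZeroExt.snd_mul, hψ, hψ, op_smul_eq_smul], fun _ => rfl⟩

/-- A derivation of a domain with values in its fraction field, given as a homomorphism to the
dual numbers, extends to the fraction field. -/
theorem exists_derivation_extending {B L : Type*} [CommRing B] [Field L] [Algebra B L]
    [IsFractionRing B L] (h : B →+* DualNumber L)
    (hfst : (TrivSqZeroExt.fstHom ℤ L L).toRingHom.comp h = algebraMap B L) :
    ∃ D : Derivation ℤ L L, ∀ b, D (algebraMap B L b) = (h b).snd := by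
  have hfst' : ∀ b, (h b).fst = algebraMap B L b := fun b => RingHom.congr_fun hfst b
  have hu : ∀ y : nonZeroDivisors B, IsUnit (h y) := fun y => by
    rw [TrivSqZeroExt.isUnit_iff_isUnit_fst, hfst']
    exact IsLocalization.map_units L y
  let ψ : L →+* DualNumber L := IsLocalization.lift hu
  have hψ : (TrivSqZeroExt.fstHom ℤ L L).toRingHom.comp ψ = RingHom.id L := by
    refine IsLocalization.ringHom_ext (nonZeroDivisors B) ?_
    rw [RingHom.comp_assoc, IsLocalization.lift_comp, hfst, RingHom.id_comp]
  obtain ⟨D, hD⟩ := exists_derivation_eq_snd ψ fun x => RingHom.congr_fun hψ x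
  refine ⟨D, fun b => ?_⟩
  rw [hD]
  exact congrArg TrivSqZeroExt.snd (IsLocalization.lift_eq hu b)

/-- The homomorphism `K → L[ε]`, `c ↦ c + μ(dc) ε`. -/
def dualNumberHom {K L : Type*} [Field K] [Field L] [Algebra K L] (μ : Ω[K⁄ℤ] →ₗ[K] L) :
    K →+* DualNumber L where
  toFun c := TrivSqZeroExt.inl (algebraMap K L c) +
    TrivSqZeroExt.inr (μ (KaehlerDifferential.D ℤ K c))
  map_one' := by simp
  map_zero' := by simp
  map_mul' a b := by
    ext
    · simp
    · simp only [TrivSqZeroExt.snd_add, TrivSqZeroExt.snd_inl, TrivSqZeroExt.snd_inr,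
        TrivSqZeroExt.snd_mul, TrivSqZeroExt.fst_add, TrivSqZeroExt.fst_inl,
        TrivSqZeroExt.fst_inr, Derivation.leibniz, map_add, map_smul, Algebra.smul_def,
        op_smul_eq_smul, zero_add, add_zero, Algebra.algebraMap_self_apply]
  map_add' a b := by
    ext
    · simp
    · simp

theorem fst_dualNumberHom {K L : Type*} [Field K] [Field L] [Algebra K L] (μ : Ω[K⁄ℤ] →ₗ[K] L)
    (c : K) : (dualNumberHom μ c).fst = algebraMap K L c := by
  simp [dualNumberHom]

theorem snd_dualNumberHom {K L : Type*} [Field K] [Field L] [Algebra K L] (μ : Ω[K⁄ℤ] →ₗ[K] L)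
    (c : K) : (dualNumberHom μ c).snd = μ (KaehlerDifferential.D ℤ K c) := by
  simp [dualNumberHom]

/-- If the functionals on `L ⊗ Ω(K)` that vanish on `θ` come from derivations of `L`, the kernel of
`L ⊗ Ω(K) → Ω(L)` is spanned by `θ`. -/
theorem ker_mapBaseChange_eq_span {K L : Type*} [Field K] [Field L] [Algebra K L]
    (θ : L ⊗[K] Ω[K⁄ℤ]) (hθ : KaehlerDifferential.mapBaseChange ℤ K L θ = 0)
    (H : ∀ μ : L ⊗[K] Ω[K⁄ℤ] →ₗ[L] L, μ θ = 0 → ∃ D : Derivation ℤ L L,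
      ∀ c, D (algebraMap K L c) = μ (1 ⊗ₜ KaehlerDifferential.D ℤ K c)) :
    LinearMap.ker (KaehlerDifferential.mapBaseChange ℤ K L) = L ∙ θ := by
  apply le_antisymm
  · intro z hz
    by_contra hzθ
    obtain ⟨μ, hμz, hμ⟩ := Submodule.exists_le_ker_of_notMem hzθ
    obtain ⟨D, hD⟩ := H μ (hμ (Submodule.mem_span_singleton_self θ))
    -- So μ factors through Ω(K) ⊗ L → Ω(L) and must kill `z`, although it was chosen to separate
    -- `z` from the line of θ.
    have key : D.liftKaehlerDifferential ∘ₗ KaehlerDifferential.mapBaseChange ℤ K L = μ := by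
      refine TensorProduct.AlgebraTensorModule.curry_injective ?_
      ext1
      refine LinearMap.ext_on (KaehlerDifferential.span_range_derivation ℤ K) ?_
      rintro _ ⟨c, rfl⟩
      simp [hD]
    apply hμz
    rw [← key, LinearMap.comp_apply, LinearMap.mem_ker.mp hz, map_zero]
  · rwa [Submodule.span_singleton_le_iff_mem, LinearMap.mem_ker]

theorem derivation_pow_char {K : Type*} [Field K] (p : ℕ) [CharP K p] {E : Type*}
    [AddCommGroup E] [Module K E] (D : Derivation ℤ K E) (x : K) : D (x ^ p) = 0 := by
  rw [Derivation.leibniz_pow, ← Nat.cast_smul_eq_nsmul K p, CharP.cast_eq_zero, zero_smul]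

/-- If a subfield `N` contains all `p`-th powers, any element outside `N` is detected by a
derivation that vanishes on `N`. -/
theorem exists_derivation_of_notMem {K : Type*} [Field K] (p : ℕ) [Fact p.Prime] [CharP K p]
    (N : Subfield K) (hN : ∀ x, x ^ p ∈ N) (x : K) (hx : x ∉ N) :
    ∃ D : Derivation ℤ K K, (∀ y ∈ N, D y = 0) ∧ D x ≠ 0 := by
  -- N' is a maximal subfield containing N but not x. Elements outside N' have degree p over it.
  obtain ⟨N', hNN', hmax⟩ := zorn_le_nonempty₀ {N : Subfield K | x ∉ N} (by
    intro c hc hcc N₀ hN₀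
    refine ⟨sSup c, ?_, fun z hz => le_sSup hz⟩
    rw [Set.mem_ofPred_eq, Subfield.mem_sSup_of_directedOn ⟨N₀, hN₀⟩ hcc.directedOn]
    rintro ⟨S, hS, hxS⟩
    exact hc hS hxS) N hx
  have hp := (Fact.out : p.Prime)
  have hN' : ∀ y, y ^ p ∈ N' := fun y => hNN' (hN y)
  have hxN' : x ∉ N' := hmax.prop
  have hirr : ∀ y (hy : y ∉ N'), Irreducible (Polynomial.X ^ p -
      Polynomial.C (⟨y ^ p, hN' y⟩ : N')) := by
    intro y hy
    refine X_pow_sub_C_irreducible_of_prime hp fun b hb => hy ?_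
    have h1 : (b : K) ^ p = y ^ p := congrArg Subtype.val hb
    rw [← frobenius_inj K p h1]
    exact b.2
  have hmin : ∀ y (hy : y ∉ N'), minpoly N' y = Polynomial.X ^ p -
      Polynomial.C (⟨y ^ p, hN' y⟩ : N') := by
    intro y hy
    refine (minpoly.eq_of_irreducible_of_monic (hirr y hy) ?_
      (Polynomial.monic_X_pow_sub_C _ hp.ne_zero)).symm
    simp [Subfield.algebraMap_ofSubfield]
  have hdeg : ∀ y (hy : y ∉ N'), Module.finrank N' (IntermediateField.adjoin N' {y}) = p := by
    intro y hy
    have hint : IsIntegral N' y := by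
      by_contra h
      have := hmin y hy
      rw [minpoly.eq_zero h] at this
      exact (Polynomial.monic_X_pow_sub_C _ hp.ne_zero).ne_zero this.symm
    rw [IntermediateField.adjoin.finrank hint, hmin y hy, Polynomial.natDegree_X_pow_sub_C]
  -- For y outside N', maximality puts x in N'(y); both N'(x) and N'(y) have degree p, so they
  -- coincide.
  have htop : IntermediateField.adjoin N' {x} = ⊤ := by
    rw [eq_top_iff]
    intro y _
    by_cases hy : y ∈ N'
    · exact (IntermediateField.adjoin N' {x}).algebraMap_mem ⟨y, hy⟩
    have hxy : x ∈ IntermediateField.adjoin N' {y} := by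
      by_contra hxy
      have h1 : N' ≤ (IntermediateField.adjoin N' {y}).toSubfield := fun z hz =>
        (IntermediateField.adjoin N' {y}).algebraMap_mem ⟨z, hz⟩
      exact hy (hmax.le_of_ge hxy h1 (IntermediateField.mem_adjoin_simple_self N' y))
    have hle : IntermediateField.adjoin N' {x} ≤ IntermediateField.adjoin N' {y} := by
      rwa [IntermediateField.adjoin_simple_le_iff]
    have : FiniteDimensional N' (IntermediateField.adjoin N' {y}) :=
      Module.finite_of_finrank_pos (by rw [hdeg y hy]; exact hp.pos)
    rw [IntermediateField.eq_of_le_of_finrank_eq hle (by rw [hdeg x hxN', hdeg y hy])]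
    exact IntermediateField.mem_adjoin_simple_self N' y
  have hint : IsIntegral N' x := by
    by_contra h
    have := hmin x hxN'
    rw [minpoly.eq_zero h] at this
    exact (Polynomial.monic_X_pow_sub_C _ hp.ne_zero).ne_zero this.symm
  let pb : PowerBasis N' K :=
    (IntermediateField.adjoin.powerBasis hint).map
      ((IntermediateField.equivOfEq htop).trans IntermediateField.topEquiv)
  have hgen : pb.gen = x := rfl
  -- x ↦ x + ε is admissible because (x + ε)^p = x^p in characteristic p; the resulting derivation
  -- takes the value 1 at x.
  let ψ : K →ₐ[N'] DualNumber K := pb.lift (TrivSqZeroExt.inl x + TrivSqZeroExt.inr 1) (by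
    rw [hgen, hmin x hxN']
    rw [map_sub, map_pow, Polynomial.aeval_X, Polynomial.aeval_C, sub_eq_zero]
    refine TrivSqZeroExt.ext ?_ ?_
    · rw [TrivSqZeroExt.fst_pow, TrivSqZeroExt.fst_add, TrivSqZeroExt.fst_inl,
        TrivSqZeroExt.fst_inr, add_zero]
      rfl
    · rw [TrivSqZeroExt.snd_pow, ← Nat.cast_smul_eq_nsmul K p, CharP.cast_eq_zero, zero_smul]
      rfl)
  have hψx : ψ x = TrivSqZeroExt.inl x + TrivSqZeroExt.inr 1 := by
    conv_lhs => rw [← hgen]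
    exact pb.lift_gen _ _
  have hψ : (TrivSqZeroExt.fstHom N' K K).comp ψ = AlgHom.id N' K := by
    refine pb.algHom_ext ?_
    rw [hgen, AlgHom.comp_apply, hψx]
    simp
  obtain ⟨D, hD⟩ := exists_derivation_eq_snd (ψ : K →+* DualNumber K)
    fun y => AlgHom.congr_fun hψ y
  refine ⟨D, fun y hy => ?_, ?_⟩
  · rw [hD]
    exact congrArg TrivSqZeroExt.snd (ψ.commutes ⟨y, hNN' hy⟩)
  · rw [hD]
    change (ψ x).snd ≠ 0
    rw [hψx]
    simp

theorem exists_pow_eq_of_D_eq_zero {K : Type*} [Field K] (p : ℕ) [Fact p.Prime] [CharP K p]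
    {x : K} (hx : KaehlerDifferential.D ℤ K x = 0) : ∃ y, y ^ p = x := by
  by_contra h
  obtain ⟨D, -, hD⟩ := exists_derivation_of_notMem p (frobenius K p).fieldRange
    (fun y => ⟨y, rfl⟩) x h
  apply hD
  rw [← D.liftKaehlerDifferential_comp_D, hx, map_zero]

end Derivations

/-! ### Restriction of differential forms to an extension field -/

section Restriction

variable {F : Type u} (K L : Type u) [Field F] [Field K] [Field L] [Algebra F K] [Algebra K L]
  [Algebra F L]

/-- Extension of scalars `⋀ Ω¹(F) → ⋀ Ω¹(K)`. -/
def formRes : ExteriorAlgebra F (Ω[F⁄ℤ]) →ₐ[F] ExteriorAlgebra K (Ω[K⁄ℤ]) :=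
  exteriorMap K (KaehlerDifferential.map ℤ ℤ F K)

/-- `d a` as an element of the exterior algebra. -/
abbrev dE (a : F) : ExteriorAlgebra F (Ω[F⁄ℤ]) :=
  ExteriorAlgebra.ι F (KaehlerDifferential.D ℤ F a)

@[simp]
theorem formRes_dE (a : F) : formRes K (dE a) = dE (algebraMap F K a) := by
  rw [formRes, exteriorMap_ι, KaehlerDifferential.map_D]

theorem formRes_ιMulti {n : ℕ} (v : Fin n → Ω[F⁄ℤ]) :
    formRes K (ExteriorAlgebra.ιMulti F n v) =
      ExteriorAlgebra.ιMulti K n fun i => KaehlerDifferential.map ℤ ℤ F K (v i) := by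
  rw [ExteriorAlgebra.ιMulti_apply, ExteriorAlgebra.ιMulti_apply, map_list_prod, List.map_ofFn]
  congr 2
  funext i
  exact exteriorMap_ι _ _ _

theorem coe_restr {n : ℕ} (ω : DiffForm n F) :
    (restr n F K ω : ExteriorAlgebra K (Ω[K⁄ℤ])) = formRes K (ω : ExteriorAlgebra F (Ω[F⁄ℤ])) := by
  let f : DiffForm n F →ₗ[F] ExteriorAlgebra K (Ω[K⁄ℤ]) :=
    ((DiffForm n K).subtype.restrictScalars F).comp (restr n F K)
  let g : DiffForm n F →ₗ[F] ExteriorAlgebra K (Ω[K⁄ℤ]) :=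
    (formRes K).toLinearMap.comp (DiffForm n F).subtype
  suffices h : f = g from LinearMap.congr_fun h ω
  refine exteriorPower.linearMap_ext (AlternatingMap.ext fun v => ?_)
  change (restr n F K (exteriorPower.ιMulti F n v) : ExteriorAlgebra K (Ω[K⁄ℤ])) =
    formRes K (ExteriorAlgebra.ιMulti F n v)
  rw [formRes_ιMulti, restr, exteriorPower.alternatingMapLinearEquiv_apply_ιMulti]
  rfl

/-- Moves the problem to the full exterior algebra, where restriction is a ring homomorphism and the
degree plays no role. -/
theorem mem_omegaKernel_iff {n : ℕ} (ω : DiffForm n F) :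
    ω ∈ omegaKernel n F K ↔ formRes K (ω : ExteriorAlgebra F (Ω[F⁄ℤ])) = 0 := by
  rw [← coe_restr]
  exact (Submodule.coe_eq_zero).symm

theorem formRes_formRes [IsScalarTower F K L] (x : ExteriorAlgebra F (Ω[F⁄ℤ])) :
    formRes L (formRes K x) = formRes L x := by
  induction x using ExteriorAlgebra.induction with
  | algebraMap r =>
    rw [AlgHom.commutes, AlgHom.commutes, IsScalarTower.algebraMap_apply F K, AlgHom.commutes,
      ← IsScalarTower.algebraMap_apply]
  | ι v =>
    simp only [formRes, exteriorMap_ι]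
    congr 1
    refine LinearMap.congr_fun (f := (((KaehlerDifferential.map ℤ ℤ K L).restrictScalars F).comp
      (KaehlerDifferential.map ℤ ℤ F K))) (g := KaehlerDifferential.map ℤ ℤ F L) ?_ v
    refine LinearMap.ext_on (KaehlerDifferential.span_range_derivation ℤ F) ?_
    rintro _ ⟨c, rfl⟩
    simp only [LinearMap.comp_apply, LinearMap.restrictScalars_apply, KaehlerDifferential.map_D,
      IsScalarTower.algebraMap_apply F K L]
  | mul a b ha hb => simp only [map_mul, ha, hb]
  | add a b ha hb => simp only [map_add, ha, hb]

theorem formRes_injective_of_ker_eq_bot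
    (h : LinearMap.ker (KaehlerDifferential.mapBaseChange ℤ F K) = ⊥) :
    Function.Injective (formRes (F := F) K) := by
  rw [injective_iff_map_eq_zero]
  intro x hx
  rw [formRes, exteriorMap_eq_map_comp K _ (KaehlerDifferential.mapBaseChange ℤ F K)
    (fun v => by simp)] at hx
  refine exteriorMap_mk_injective K ?_
  rw [map_zero]
  exact ExteriorAlgebra.map_injective_field h (hx.trans (map_zero _).symm)

/-- If the kernel of `K ⊗ Ω(F) → Ω(K)` is spanned by `∑ yᵢ ⊗ d cᵢ` with `yᵢ` linearly independent,
the kernel on forms consists of the `x` that are annihilated by all `d cᵢ`. -/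
theorem formRes_eq_zero_iff_of_ker_eq_span {ι : Type*} [Fintype ι] {y : ι → K}
    (hy : LinearIndependent F y) (v : ι → Ω[F⁄ℤ]) (hv : ∃ i, v i ≠ 0)
    (h : LinearMap.ker (KaehlerDifferential.mapBaseChange ℤ F K) = K ∙ ∑ i, y i ⊗ₜ[F] v i)
    (x : ExteriorAlgebra F (Ω[F⁄ℤ])) :
    formRes K x = 0 ↔ ∀ i, ExteriorAlgebra.ι F (v i) * x = 0 := by
  let B := exteriorMap K (TensorProduct.mk F K (Ω[F⁄ℤ]) 1)
  have hsum : ∀ z, ExteriorAlgebra.ι K (∑ i, y i ⊗ₜ[F] v i) * B z =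
      ∑ i, y i • B (ExteriorAlgebra.ι F (v i) * z) := by
    intro z
    rw [map_sum, Finset.sum_mul]
    refine Finset.sum_congr rfl fun i _ => ?_
    rw [map_mul, exteriorMap_ι, TensorProduct.mk_apply, ← smul_mul_assoc, ← map_smul,
      TensorProduct.smul_tmul', smul_eq_mul, mul_one]
  have hθ : (∑ i, y i ⊗ₜ[F] v i) ≠ 0 := by
    intro h0
    obtain ⟨i, hi⟩ := hv
    have h1 := hsum 1
    rw [h0, map_zero, zero_mul] at h1
    have h2 := eq_zero_of_sum_smul_exteriorMap_eq_zero K hy _ h1.symm i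
    rw [mul_one, ExteriorAlgebra.ι_eq_zero_iff] at h2
    exact hi h2
  rw [formRes, exteriorMap_eq_map_comp K _ (KaehlerDifferential.mapBaseChange ℤ F K)
    (fun v => by simp), map_eq_zero_iff_of_ker_eq_span hθ h, hsum]
  exact ⟨fun h i => eq_zero_of_sum_smul_exteriorMap_eq_zero K hy _ h i,
    fun h => Finset.sum_eq_zero fun i _ => by rw [h i, map_zero, smul_zero]⟩

end Restriction

/-! ### Differential forms over the function field of one p-form -/

namespace PForm

variable {K : Type u} [Field K] (p : ℕ)

theorem aeval_poly (φ : PForm K) {A : Type*} [CommRing A] [Algebra K A] (x : Fin φ.dim → A) :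
    MvPolynomial.aeval x (φ.poly p) = ∑ i, φ.coeff i • x i ^ p := by
  simp [poly, Algebra.smul_def]

variable [Fact p.Prime] [CharP K p] (φ : PForm K)

section GenericPoint

variable (L : Type u) [Field L] [Algebra K L]
  [Algebra (MvPolynomial (Fin φ.dim) K ⧸ φ.functionFieldIdeal p) L]
  [IsScalarTower K (MvPolynomial (Fin φ.dim) K ⧸ φ.functionFieldIdeal p) L]


/-- The generic point of the form: the images of the variables in the function field. -/
def gen (i : Fin φ.dim) : L :=
  algebraMap (MvPolynomial (Fin φ.dim) K ⧸ φ.functionFieldIdeal p) L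
    (Ideal.Quotient.mk _ (MvPolynomial.X i))

theorem algebraMap_mk_eq_aeval (f : MvPolynomial (Fin φ.dim) K) :
    algebraMap (MvPolynomial (Fin φ.dim) K ⧸ φ.functionFieldIdeal p) L
      (Ideal.Quotient.mk _ f) = MvPolynomial.aeval (φ.gen p L) f := by
  let g : MvPolynomial (Fin φ.dim) K →ₐ[K] L :=
    (IsScalarTower.toAlgHom K (MvPolynomial (Fin φ.dim) K ⧸ φ.functionFieldIdeal p)
      L).comp (Ideal.Quotient.mkₐ K _)
  have : g = MvPolynomial.aeval (φ.gen p L) := by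
    ext i
    rw [MvPolynomial.aeval_X]
    rfl
  exact AlgHom.congr_fun this f

variable [IsFractionRing (MvPolynomial (Fin φ.dim) K ⧸ φ.functionFieldIdeal p) L]

theorem aeval_gen_eq_zero_iff (f : MvPolynomial (Fin φ.dim) K) :
    MvPolynomial.aeval (φ.gen p L) f = 0 ↔ f ∈ φ.functionFieldIdeal p := by
  rw [← algebraMap_mk_eq_aeval, ← Ideal.Quotient.eq_zero_iff_mem]
  exact (IsFractionRing.injective (MvPolynomial (Fin φ.dim) K ⧸ φ.functionFieldIdeal p) L).eq_iff' (map_zero _)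

theorem sum_coeff_smul_gen_pow (h : 1 < φ.normDegree p) :
    ∑ i, φ.coeff i • φ.gen p L i ^ p = 0 := by
  rw [← aeval_poly, aeval_gen_eq_zero_iff, functionFieldIdeal, if_pos h]
  exact Ideal.mem_span_singleton_self _

/-- A linear relation among the x_i^p with i ≠ i₀ makes ∑ g_i X_i^p a multiple of the polynomial of
φ; a specialization to one variable excludes this by degree. -/
theorem linearIndependent_gen_pow (h : 1 < φ.normDegree p) {i₀ : Fin φ.dim}
    (hi₀ : φ.coeff i₀ = 1) :
    LinearIndependent K fun i : {i // i ≠ i₀} => φ.gen p L i ^ p := by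
  classical
  have hp := (Fact.out : p.Prime)
  rw [Fintype.linearIndependent_iff]
  intro g hg j
  have hmem : (∑ i : {i // i ≠ i₀}, g i • MvPolynomial.X (i : Fin φ.dim) ^ p :
        MvPolynomial (Fin φ.dim) K) ∈
      φ.functionFieldIdeal p := by
    rw [← aeval_gen_eq_zero_iff p φ L]
    simpa using hg
  rw [functionFieldIdeal, if_pos h, Ideal.mem_span_singleton] at hmem
  -- Under this substitution the polynomial of φ becomes X^p + c_j and the relation becomes the
  -- constant g_j.
  let e : Fin φ.dim → Polynomial K := fun k =>
    if k = i₀ then Polynomial.X else if k = j then 1 else 0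
  have hdvd := map_dvd (MvPolynomial.aeval e) hmem
  have h1 : MvPolynomial.aeval e (φ.poly p) = Polynomial.X ^ p + Polynomial.C (φ.coeff j) := by
    rw [aeval_poly, Finset.sum_eq_add i₀ j j.2.symm]
    · simp [e, hi₀, j.2, Polynomial.smul_eq_C_mul]
    · intro k _ hk
      simp [e, hk.1, hk.2, hp.ne_zero]
    · simp
    · simp
  have h2 : MvPolynomial.aeval e
      (∑ i : {i // i ≠ i₀}, g i • MvPolynomial.X (i : Fin φ.dim) ^ p :
        MvPolynomial (Fin φ.dim) K) = Polynomial.C (g j) := by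
    rw [map_sum, Finset.sum_eq_single j]
    · simp [e, j.2, Polynomial.smul_eq_C_mul]
    · intro k _ hk
      have : (k : Fin φ.dim) ≠ j := fun h => hk (Subtype.ext h)
      simp [e, k.2, this, hp.ne_zero]
    · simp
  rw [h1, h2] at hdvd
  have := Polynomial.eq_zero_of_dvd_of_degree_lt hdvd (by
    rw [Polynomial.degree_X_pow_add_C hp.pos]
    exact Polynomial.degree_C_le.trans_lt (by exact_mod_cast hp.pos))
  simpa using this

/-- The element `∑ xᵢ^p ⊗ d cᵢ`. -/
def genTensor : L ⊗[K] Ω[K⁄ℤ] :=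
  ∑ i, (φ.gen p L i ^ p) ⊗ₜ[K] KaehlerDifferential.D ℤ K (φ.coeff i)

/-- A functional on `L ⊗ Ω(K)`, `L = K(φ)`, comes from a derivation of `L` as soon as the
corresponding homomorphism to the dual numbers is compatible with the equation of `φ`. -/
theorem exists_derivation_functionField (μ : L ⊗[K] Ω[K⁄ℤ] →ₗ[L]
    L) (hμ : 1 < φ.normDegree p → μ (φ.genTensor p L) = 0) :
    ∃ D : Derivation ℤ L L,
      ∀ c, D (algebraMap K _ c) = μ (1 ⊗ₜ KaehlerDifferential.D ℤ K c) := by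
  let ν : Ω[K⁄ℤ] →ₗ[K] L := (μ.restrictScalars K).comp (TensorProduct.mk K L _ 1)
  -- Scalars are deformed by c ↦ c + μ(1 ⊗ dc) ε, while the generic point stays fixed.
  let h₀ : MvPolynomial (Fin φ.dim) K →+* DualNumber L :=
    MvPolynomial.eval₂Hom (dualNumberHom ν) fun i => TrivSqZeroExt.inl (φ.gen p L i)
  have h₀C : ∀ c, h₀ (MvPolynomial.C c) = dualNumberHom ν c := fun c =>
    MvPolynomial.eval₂Hom_C _ _ _
  have h₀X : ∀ i, h₀ (MvPolynomial.X i) = TrivSqZeroExt.inl (φ.gen p L i) := fun i =>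
    MvPolynomial.eval₂Hom_X' _ _ _
  have hfst : (TrivSqZeroExt.fstHom ℤ L L).toRingHom.comp h₀ =
      (MvPolynomial.aeval (φ.gen p L) : MvPolynomial (Fin φ.dim) K →ₐ[K] L) := by
    refine MvPolynomial.ringHom_ext (fun c => ?_) fun i => ?_
    · change (h₀ (MvPolynomial.C c)).fst = MvPolynomial.aeval (φ.gen p L) (MvPolynomial.C c)
      rw [h₀C, fst_dualNumberHom, MvPolynomial.aeval_C]
    · change (h₀ (MvPolynomial.X i)).fst = MvPolynomial.aeval (φ.gen p L) (MvPolynomial.X i)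
      rw [h₀X, MvPolynomial.aeval_X, TrivSqZeroExt.fst_inl]
  have hker : ∀ f ∈ φ.functionFieldIdeal p, h₀ f = 0 := by
    intro f hf
    by_cases h : 1 < φ.normDegree p
    · rw [functionFieldIdeal, if_pos h, Ideal.mem_span_singleton] at hf
      refine zero_dvd_iff.mp (Dvd.dvd.trans (dvd_of_eq (Eq.symm ?_)) (map_dvd h₀ hf))
      refine TrivSqZeroExt.ext ?_ ?_
      · refine (RingHom.congr_fun hfst (φ.poly p)).trans ?_
        change MvPolynomial.aeval (φ.gen p L) (φ.poly p) = 0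
        rw [aeval_poly, sum_coeff_smul_gen_pow p φ L h]
      -- The ε-part of the image of the equation is ∑ x_i^p μ(1 ⊗ dc_i) = μ(θ).
      · rw [poly, map_sum]
        change (TrivSqZeroExt.sndHom L L) _ = 0
        rw [map_sum]
        refine Eq.trans ?_ (hμ h)
        rw [genTensor, map_sum]
        refine Finset.sum_congr rfl fun i _ => ?_
        rw [TrivSqZeroExt.sndHom_apply, map_mul, map_pow, h₀C, h₀X, TrivSqZeroExt.inl_pow,
          TrivSqZeroExt.snd_mul, TrivSqZeroExt.snd_inl, TrivSqZeroExt.fst_inl, smul_zero, zero_add,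
          snd_dualNumberHom, op_smul_eq_smul]
        change _ • μ _ = _
        rw [← map_smul, TensorProduct.mk_apply, TensorProduct.smul_tmul', smul_eq_mul, mul_one]
    · rw [functionFieldIdeal, if_neg h, Ideal.mem_bot] at hf
      rw [hf, map_zero]
  obtain ⟨D, hD⟩ := exists_derivation_extending (L := L)
    (Ideal.Quotient.lift (φ.functionFieldIdeal p) h₀ hker) (by
      refine Ideal.Quotient.ringHom_ext ?_
      refine RingHom.ext fun f => ?_
      exact (RingHom.congr_fun hfst f).trans (φ.algebraMap_mk_eq_aeval p L f).symm)
  refine ⟨D, fun c => ?_⟩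
  have h1 : algebraMap K L c = algebraMap (MvPolynomial (Fin φ.dim) K ⧸ φ.functionFieldIdeal p) L
      (Ideal.Quotient.mk _ (MvPolynomial.C c)) := by
    rw [algebraMap_mk_eq_aeval, MvPolynomial.aeval_C]
  change D (algebraMap K L c) = _
  rw [h1, hD, Ideal.Quotient.lift_mk, h₀C, snd_dualNumberHom]
  rfl

theorem ker_mapBaseChange_functionField (h : 1 < φ.normDegree p) :
    LinearMap.ker (KaehlerDifferential.mapBaseChange ℤ K L) =
      L ∙ φ.genTensor p L := by
  have : CharP L p := charP_of_injective_algebraMap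
      (algebraMap K L).injective p
  refine ker_mapBaseChange_eq_span _ ?_ fun μ hμ =>
    φ.exists_derivation_functionField p L μ fun _ => hμ
  have h1 := congrArg (KaehlerDifferential.D ℤ L)
    (φ.sum_coeff_smul_gen_pow p L h)
  rw [map_sum, map_zero] at h1
  rw [genTensor, map_sum, ← h1]
  refine Finset.sum_congr rfl fun i _ => ?_
  rw [KaehlerDifferential.mapBaseChange_tmul, KaehlerDifferential.map_D, Algebra.smul_def,
    Derivation.leibniz, derivation_pow_char p, smul_zero, zero_add]

theorem ker_mapBaseChange_functionField_eq_bot (h : ¬ 1 < φ.normDegree p) :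
    LinearMap.ker (KaehlerDifferential.mapBaseChange ℤ K L) = ⊥ := by
  rw [ker_mapBaseChange_eq_span 0 (map_zero _) fun μ _ =>
    φ.exists_derivation_functionField p L μ fun h' => absurd h' h, Submodule.span_zero_singleton]

end GenericPoint

theorem coeff_mem_normField {i₀ : Fin φ.dim} (hi₀ : φ.coeff i₀ = 1) (i : Fin φ.dim) :
    φ.coeff i ∈ φ.normField p := by
  classical
  have hp := (Fact.out : p.Prime)
  have hval : ∀ j, φ.eval p (Pi.single j 1) = φ.coeff j := fun j => by
    rw [eval, Finset.sum_eq_single j]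
    · simp
    · intro k _ hk; simp [Pi.single_eq_of_ne hk, hp.ne_zero]
    · simp
  rcases eq_or_ne (φ.coeff i) 0 with h0 | h0
  · rw [h0]; exact zero_mem _
  · refine IntermediateField.subset_adjoin _ _ ⟨φ.coeff i, ⟨h0, _, hval i⟩, 1, ⟨one_ne_zero,
      _, (hval i₀).trans hi₀⟩, by rw [div_one]⟩

theorem eval_mem {S : IntermediateField (powField p K) K} (hS : ∀ i, φ.coeff i ∈ S)
    (v : Fin φ.dim → K) : φ.eval p v ∈ S :=
  sum_mem fun i _ => mul_mem (hS i) (S.algebraMap_mem ⟨v i ^ p, v i, rfl⟩)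

theorem normField_le {S : IntermediateField (powField p K) K} (hS : ∀ i, φ.coeff i ∈ S) :
    φ.normField p ≤ S := by
  refine IntermediateField.adjoin_le_iff.mpr ?_
  rintro _ ⟨_, ⟨-, v, rfl⟩, _, ⟨-, w, rfl⟩, rfl⟩
  exact div_mem (φ.eval_mem p hS v) (φ.eval_mem p hS w)

theorem one_lt_normDegree_iff {i₀ : Fin φ.dim} (hi₀ : φ.coeff i₀ = 1) :
    1 < φ.normDegree p ↔ ∃ i, ∀ y, y ^ p ≠ φ.coeff i := by
  constructor
  · intro h
    by_contra! hc
    obtain ⟨i, -, j, hj⟩ := φ.exists_of_one_lt_normDegree p h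
    obtain ⟨y, hy⟩ := hc i
    obtain ⟨z, hz⟩ := hc j
    exact hj (z / y) (by rw [div_pow, hy, hz])
  · rintro ⟨i, hi⟩
    -- `finrank` is 0 for infinite extensions, so norm degree 0 has to be excluded: the norm field
    -- lies in an extension of F^p generated by finitely many p-th roots.
    have hfin : FiniteDimensional (powField p K) (powAdjoin p (Set.range φ.coeff)) := by
      have : Finite (Set.range φ.coeff) := Set.finite_range _
      refine IntermediateField.finiteDimensional_adjoin fun x _ => ?_
      exact IsIntegral.of_pow (Fact.out : p.Prime).pos
        (isIntegral_algebraMap (x := (⟨x ^ p, x, rfl⟩ : powField p K)))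
    have hle : φ.normField p ≤ powAdjoin p (Set.range φ.coeff) :=
      φ.normField_le p fun i => IntermediateField.subset_adjoin _ _ ⟨i, rfl⟩
    have hfin' : FiniteDimensional (powField p K) (φ.normField p) :=
      FiniteDimensional.of_injective (IntermediateField.inclusion hle).toLinearMap
        (IntermediateField.inclusion_injective hle)
    have h0 : 0 < φ.normDegree p := Module.finrank_pos
    refine lt_of_le_of_ne h0 fun h1 => ?_
    have hbot := IntermediateField.finrank_eq_one_iff.mp h1.symm
    have hmem := φ.coeff_mem_normField p hi₀ i
    rw [hbot, IntermediateField.mem_bot] at hmem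
    obtain ⟨⟨_, y, rfl⟩, hy⟩ := hmem
    exact hi y hy

/-- The kernel of `Ω(K) → Ω(K(φ))` for a form of norm degree greater than `1`. -/
theorem formRes_functionField_eq_zero_iff {i₀ : Fin φ.dim} (hi₀ : φ.coeff i₀ = 1)
    (h : 1 < φ.normDegree p) (x : ExteriorAlgebra K (Ω[K⁄ℤ])) :
    formRes (φ.FunctionField p) x = 0 ↔ ∀ i, dE (φ.coeff i) * x = 0 := by
  classical
  -- The summand at i₀ drops out of θ because d1 = 0; the remaining x_i^p are independent.
  have hD : KaehlerDifferential.D ℤ K (φ.coeff i₀) = 0 := by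
    rw [hi₀, Derivation.map_one_eq_zero]
  have hker := φ.ker_mapBaseChange_functionField p (φ.FunctionField p) h
  rw [genTensor, ← Finset.add_sum_erase _ _ (Finset.mem_univ i₀), hD, TensorProduct.tmul_zero,
    zero_add, Finset.sum_subtype (p := fun k => k ≠ i₀) _ (by simp)] at hker
  rw [formRes_eq_zero_iff_of_ker_eq_span _ (φ.linearIndependent_gen_pow p (φ.FunctionField p) h hi₀) _ ?_ hker]
  · refine ⟨fun H i => ?_, fun H i => H i⟩
    rcases eq_or_ne i i₀ with rfl | hi
    · rw [dE, hD, map_zero, zero_mul]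
    · exact H ⟨i, hi⟩
  · obtain ⟨i, hi⟩ := (φ.one_lt_normDegree_iff p hi₀).mp h
    refine ⟨⟨i, ?_⟩, fun h0 => ?_⟩
    · rintro rfl
      exact hi 1 (by rw [one_pow, hi₀])
    · obtain ⟨y, hy⟩ := exists_pow_eq_of_D_eq_zero p h0
      exact hi y hy

theorem formRes_functionField_injective (h : ¬ 1 < φ.normDegree p) :
    Function.Injective (formRes (F := K) (φ.FunctionField p)) :=
  formRes_injective_of_ker_eq_bot _ (φ.ker_mapBaseChange_functionField_eq_bot p (φ.FunctionField p) h)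

end PForm

/-! ### Iterated function fields -/

section Iteration

variable {F : Type u} [Field F]

theorem formRes_self (x : ExteriorAlgebra F (Ω[F⁄ℤ])) : formRes F x = x := by
  have h : formRes (F := F) F = AlgHom.id F _ := by
    refine ExteriorAlgebra.hom_ext (LinearMap.ext_on
      (KaehlerDifferential.span_range_derivation ℤ F) ?_)
    rintro _ ⟨c, rfl⟩
    exact formRes_dE F c
  rw [h, AlgHom.id_apply]

variable {p : ℕ} [Fact p.Prime]

/-- By `h`, some coefficient has nonzero differential over K, so it is no p-th power there and the
form keeps norm degree greater than 1. -/
theorem formRes_step_eq_zero_iff (K : FieldExt p F) (ψ : PForm F) {i₀ : Fin ψ.dim}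
    (hi₀ : ψ.coeff i₀ = 1) (h : ∃ i, formRes K.carrier (dE (ψ.coeff i)) ≠ 0)
    (x : ExteriorAlgebra F (Ω[F⁄ℤ])) :
    formRes (K.step ψ).carrier x = 0 ↔
      ∀ i, formRes K.carrier (dE (ψ.coeff i) * x) = 0 := by
  have hi₀' : (ψ.baseChange K.carrier).coeff i₀ = 1 :=
    (congrArg (algebraMap F K.carrier) hi₀).trans (map_one _)
  have hdeg : 1 < (ψ.baseChange K.carrier).normDegree p := by
    rw [PForm.one_lt_normDegree_iff p _ hi₀']
    obtain ⟨i, hi⟩ := h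
    refine ⟨i, fun y hy => hi ?_⟩
    rw [formRes_dE]
    change dE ((ψ.baseChange K.carrier).coeff i) = 0
    rw [← hy, dE, derivation_pow_char p, map_zero]
  change formRes ((ψ.baseChange K.carrier).FunctionField p) x = 0 ↔ _
  rw [← formRes_formRes K.carrier, PForm.formRes_functionField_eq_zero_iff p _ hi₀' hdeg]
  simp only [map_mul, formRes_dE]
  rfl

theorem formRes_step_eq_zero_iff_of_forall (K : FieldExt p F) (ψ : PForm F) {i₀ : Fin ψ.dim}
    (hi₀ : ψ.coeff i₀ = 1) (h : ∀ i, formRes K.carrier (dE (ψ.coeff i)) = 0)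
    (x : ExteriorAlgebra F (Ω[F⁄ℤ])) :
    formRes (K.step ψ).carrier x = 0 ↔ formRes K.carrier x = 0 := by
  have hi₀' : (ψ.baseChange K.carrier).coeff i₀ = 1 :=
    (congrArg (algebraMap F K.carrier) hi₀).trans (map_one _)
  have hdeg : ¬ 1 < (ψ.baseChange K.carrier).normDegree p := by
    rw [PForm.one_lt_normDegree_iff p _ hi₀']
    push Not
    intro i
    refine exists_pow_eq_of_D_eq_zero p ((ExteriorAlgebra.ι_eq_zero_iff (R := K.carrier) _).mp ?_)
    exact (formRes_dE _ _).symm.trans (h i)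
  change formRes ((ψ.baseChange K.carrier).FunctionField p) x = 0 ↔ _
  rw [← formRes_formRes K.carrier,
    (PForm.formRes_functionField_injective p _ hdeg).eq_iff' (map_zero _)]

/-- The form `d c₁ ∧ … ∧ d cᵣ` with `cᵢ` the chosen coefficient of `φᵢ`. -/
def coeffWedge (φ : ℕ → PForm F) (r : ℕ) (j : ∀ i : Fin r, Fin (φ i).dim) :
    ExteriorAlgebra F (Ω[F⁄ℤ]) :=
  ExteriorAlgebra.ιMulti F r fun i => KaehlerDifferential.D ℤ F ((φ i).coeff (j i))

theorem coeffWedge_succ (φ : ℕ → PForm F) (r : ℕ) (j : ∀ i : Fin (r + 1), Fin (φ i).dim) :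
    coeffWedge φ (r + 1) j =
      coeffWedge φ r (fun i => j i.castSucc) * dE ((φ r).coeff (j (Fin.last r))) :=
  ιMulti_snoc _

variable [CharP F p] (φ : ℕ → PForm F)

theorem iterFunctionField_zero (ψ : Fin 0 → PForm F) :
    iterFunctionField p 0 ψ = { carrier := F } := rfl

theorem iterFunctionField_succ (r : ℕ) :
    (iterFunctionField p (r + 1) fun i => φ i) =
      (iterFunctionField p r fun i => φ i).step (φ r) := rfl

/-- Each step multiplies by the differential of one more coefficient. Nonvanishing of a wedge passes
to its left factors, which keeps every intermediate step in the case of norm degree greater than 1.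
-/
theorem formRes_iterFunctionField_eq_zero_iff (hφ : ∀ i, ∃ i₀, (φ i).coeff i₀ = 1) (r : ℕ)
    (h : ∃ j, coeffWedge φ r j ≠ 0)
    (x : ExteriorAlgebra F (Ω[F⁄ℤ])) :
    formRes (iterFunctionField p r fun i => φ i).carrier x = 0 ↔ ∀ j, coeffWedge φ r j * x = 0 := by
  induction r generalizing x with
  | zero =>
    rw [iterFunctionField_zero, formRes_self]
    simp [coeffWedge]
  | succ r ih =>
    obtain ⟨j₀, hj₀⟩ := h
    rw [coeffWedge_succ] at hj₀
    have ih := ih ⟨_, left_ne_zero_of_mul hj₀⟩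
    obtain ⟨i₀, hi₀⟩ := hφ r
    rw [iterFunctionField_succ, formRes_step_eq_zero_iff _ _ hi₀]
    · simp only [ih, coeffWedge_succ, mul_assoc]
      refine ⟨fun H j => H _ _, fun H l j => ?_⟩
      have := H (Fin.snoc (α := fun i : Fin (r + 1) => Fin (φ i).dim) j l)
      simpa using this
    -- If this differential died over F_r, the induction hypothesis would make its product with
    -- every shorter wedge zero, including the chosen nonzero one.
    · refine ⟨j₀ (Fin.last r), fun h0 => hj₀ ?_⟩
      exact (ih _).mp h0 _

/-- By `h'` all coefficients of the forms after the first `s` have zero differential over the field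
already reached, so those steps are injective on forms. -/
theorem formRes_iterFunctionField_eq_zero_iff_of_le (hφ : ∀ i, ∃ i₀, (φ i).coeff i₀ = 1)
    {s r : ℕ} (hsr : s ≤ r)
    (h : ∃ j, coeffWedge φ s j ≠ 0)
    (h' : ∀ i, s ≤ i → i < r → ∀ j l, coeffWedge φ s j * dE ((φ i).coeff l) = 0)
    (x : ExteriorAlgebra F (Ω[F⁄ℤ])) :
    formRes (iterFunctionField p r fun i => φ i).carrier x = 0 ↔ ∀ j, coeffWedge φ s j * x = 0 := by
  induction r, hsr using Nat.le_induction generalizing x with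
  | base => exact formRes_iterFunctionField_eq_zero_iff φ hφ s h x
  | succ r hsr ih =>
    have ih := ih fun i hi hir => h' i hi (hir.trans r.lt_succ_self)
    obtain ⟨i₀, hi₀⟩ := hφ r
    rw [iterFunctionField_succ, formRes_step_eq_zero_iff_of_forall _ _ hi₀, ih]
    exact fun l => (ih _).mpr fun j => h' r hsr r.lt_succ_self j l

end Iteration

/-! ### Fields generated by p-th roots and independence of differentials -/

section Roots

variable {K : Type u} [Field K]

/-- The subfield of elements whose differential lies in a given subspace. -/
def diffSubfield (S : Submodule K (Ω[K⁄ℤ])) : Subfield K where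
  carrier := {x | KaehlerDifferential.D ℤ K x ∈ S}
  mul_mem' {a b} ha hb := by
    change KaehlerDifferential.D ℤ K (a * b) ∈ S
    rw [Derivation.leibniz]
    exact add_mem (S.smul_mem _ hb) (S.smul_mem _ ha)
  one_mem' := by
    change KaehlerDifferential.D ℤ K 1 ∈ S
    rw [Derivation.map_one_eq_zero]
    exact zero_mem S
  add_mem' {a b} ha hb := by
    change KaehlerDifferential.D ℤ K (a + b) ∈ S
    rw [map_add]
    exact add_mem ha hb
  zero_mem' := by
    change KaehlerDifferential.D ℤ K 0 ∈ S
    rw [map_zero]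
    exact zero_mem S
  neg_mem' {a} ha := by
    change KaehlerDifferential.D ℤ K (-a) ∈ S
    rw [map_neg]
    exact neg_mem ha
  inv_mem' a ha := by
    change KaehlerDifferential.D ℤ K a⁻¹ ∈ S
    rw [Derivation.leibniz_inv]
    exact S.smul_mem _ ha

theorem mem_diffSubfield {S : Submodule K (Ω[K⁄ℤ])} {x : K} :
    x ∈ diffSubfield S ↔ KaehlerDifferential.D ℤ K x ∈ S := Iff.rfl

theorem pow_mem_diffSubfield (p : ℕ) [CharP K p] (S : Submodule K (Ω[K⁄ℤ])) (x : K) : x ^ p ∈ diffSubfield S := by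
  rw [mem_diffSubfield, derivation_pow_char p]
  exact zero_mem S

theorem charP_algebraicClosure (p : ℕ) [CharP K p] : CharP (AlgebraicClosure K) p :=
  charP_of_injective_algebraMap (algebraMap K (AlgebraicClosure K)).injective p

variable (p : ℕ) {ι : Type*} (t : ι → K)

/-- The field generated by the `p`-th roots of the `tᵢ`, `i ∈ I`. -/
def rootsField (I : Set ι) : IntermediateField K (AlgebraicClosure K) :=
  IntermediateField.adjoin K {y | ∃ i ∈ I, y ^ p = algebraMap _ _ (t i)}

variable [Fact p.Prime] [CharP K p]

/-- The elements whose p-th power comes from an element of K with differential in the span form a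
field; it contains K, as d(x^p) = 0, and all the adjoined roots. -/
theorem D_mem_span_of_mem_rootsField {I : Set ι} {y : AlgebraicClosure K}
    (hy : y ∈ rootsField p t I) {m : K} (hm : y ^ p = algebraMap _ _ m) :
    KaehlerDifferential.D ℤ K m ∈
      Submodule.span K ((fun i => KaehlerDifferential.D ℤ K (t i)) '' I) := by
  have := charP_algebraicClosure (K := K) p
  set S := Submodule.span K ((fun i => KaehlerDifferential.D ℤ K (t i)) '' I)
  let E : IntermediateField K (AlgebraicClosure K) :=
    (((diffSubfield S).map (algebraMap K (AlgebraicClosure K))).comap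
      (frobenius (AlgebraicClosure K) p)).toIntermediateField fun x =>
        ⟨x ^ p, pow_mem_diffSubfield p S x, by rw [map_pow]; rfl⟩
  have hle : rootsField p t I ≤ E := by
    refine IntermediateField.adjoin_le_iff.mpr ?_
    rintro z ⟨i, hi, hz⟩
    exact ⟨t i, Submodule.subset_span ⟨i, hi, rfl⟩, hz.symm⟩
  obtain ⟨x, hx, hxy⟩ := hle hy
  have : x = m := (algebraMap K (AlgebraicClosure K)).injective (hxy.trans hm)
  exact this ▸ hx

theorem finrank_adjoin_root_le (c : K) :
    Module.finrank K (IntermediateField.adjoin K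
      {y : AlgebraicClosure K | y ^ p = algebraMap _ _ c}) ≤ p := by
  have := charP_algebraicClosure (K := K) p
  have hp := (Fact.out : p.Prime)
  obtain ⟨z, hz⟩ := IsAlgClosed.exists_pow_nat_eq (algebraMap K (AlgebraicClosure K) c) hp.pos
  have hset : {y : AlgebraicClosure K | y ^ p = algebraMap _ _ c} = {z} := by
    ext y
    refine ⟨fun hy => frobenius_inj _ p (Eq.trans hy hz.symm), ?_⟩
    rintro rfl
    exact hz
  rw [hset, IntermediateField.adjoin.finrank (Algebra.IsIntegral.isIntegral z)]
  refine (Polynomial.natDegree_le_natDegree (minpoly.min K z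
    (Polynomial.monic_X_pow_sub_C c hp.ne_zero) (by simp [hz]))).trans ?_
  rw [Polynomial.natDegree_X_pow_sub_C]

theorem finrank_rootsField_le [DecidableEq ι] (J : Finset ι) :
    Module.finrank K (rootsField p t (J : Set ι)) ≤ p ^ J.card := by
  induction J using Finset.induction_on with
  | empty =>
    have : rootsField p t ((∅ : Finset ι) : Set ι) = ⊥ := by simp [rootsField]
    rw [this, IntermediateField.finrank_bot, Finset.card_empty, pow_zero]
  | insert a J ha ih =>
    have : rootsField p t ((insert a J : Finset ι) : Set ι) = IntermediateField.adjoin K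
        {y : AlgebraicClosure K | y ^ p = algebraMap _ _ (t a)} ⊔ rootsField p t (J : Set ι) := by
      rw [rootsField, rootsField, ← IntermediateField.adjoin_union]
      congr 1
      ext y
      simp
    rw [this, Finset.card_insert_of_notMem ha, pow_succ']
    exact (IntermediateField.finrank_sup_le _ _).trans
      (Nat.mul_le_mul (finrank_adjoin_root_le p _) ih)

/-- If the `p`-th roots of the `tᵢ` generate an extension of the maximal degree, the differentials
`d tᵢ` are linearly independent. -/
theorem linearIndependent_D_of_finrank_rootsField (I : Finset ι)
    (h : Module.finrank K (rootsField p t (I : Set ι)) = p ^ I.card) :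
    LinearIndependent K fun i : I => KaehlerDifferential.D ℤ K (t i) := by
  classical
  have := charP_algebraicClosure (K := K) p
  have hp := (Fact.out : p.Prime)
  rw [Fintype.linearIndependent_iff]
  intro g hg i
  let E := rootsField p t ((I.erase i : Finset ι) : Set ι)
  -- N = K ∩ E^p, with E generated by the roots other than the i-th. If t_i were in N, that root
  -- would be redundant and the degree too small. A derivation vanishing on N but not at t_i then
  -- isolates g_i.
  let N : Subfield K := (E.toSubfield.map (frobenius (AlgebraicClosure K) p)).comap
    (algebraMap K (AlgebraicClosure K))
  have hN : ∀ x, x ^ p ∈ N := fun x =>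
    ⟨algebraMap _ _ x, E.algebraMap_mem x, by rw [map_pow]; rfl⟩
  have hti : t i ∉ N := by
    rintro ⟨z, hzE, hz⟩
    have heq : rootsField p t (I : Set ι) = E := by
      apply le_antisymm
      · refine IntermediateField.adjoin_le_iff.mpr ?_
        rintro y ⟨l, hl, hy⟩
        rcases eq_or_ne l i with rfl | hli
        · have : y = z := frobenius_inj _ p (Eq.trans hy hz.symm)
          exact this ▸ hzE
        · exact IntermediateField.subset_adjoin _ _
            ⟨l, Finset.mem_coe.mpr (Finset.mem_erase.mpr ⟨hli, hl⟩), hy⟩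
      · refine IntermediateField.adjoin.mono _ _ _ ?_
        rintro y ⟨l, hl, hy⟩
        exact ⟨l, Finset.mem_of_mem_erase hl, hy⟩
    have h1 := finrank_rootsField_le p t (I.erase i)
    change Module.finrank K E ≤ _ at h1
    rw [← heq, h] at h1
    have h2 := (Nat.pow_le_pow_iff_right hp.one_lt).mp h1
    exact absurd h2 (not_le.mpr (Finset.card_erase_lt_of_mem i.2))
  obtain ⟨D, hDN, hDi⟩ := exists_derivation_of_notMem p N hN (t i) hti
  have hD : ∀ l : I, l ≠ i → D (t l) = 0 := by
    intro l hl
    obtain ⟨z, hz⟩ := IsAlgClosed.exists_pow_nat_eq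
      (algebraMap K (AlgebraicClosure K) (t l)) hp.pos
    refine hDN _ ⟨z, IntermediateField.subset_adjoin _ _ ⟨l, ?_, hz⟩, hz⟩
    exact Finset.mem_coe.mpr (Finset.mem_erase.mpr ⟨fun h => hl (Subtype.ext h), l.2⟩)
  have h1 := congrArg D.liftKaehlerDifferential hg
  rw [map_sum, map_zero, Finset.sum_eq_single i] at h1
  · rw [map_smul, Derivation.liftKaehlerDifferential_comp_D, smul_eq_mul] at h1
    exact (mul_eq_zero.mp h1).resolve_right hDi
  · intro l _ hl
    rw [map_smul, Derivation.liftKaehlerDifferential_comp_D, hD l hl, smul_zero]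
  · simp

end Roots

/-! ### The generic values T_i and wedges of coefficient differentials -/

section GenericValues

theorem exists_derivation_fractionField {F : Type u} [Field F] (σ : Type*) (M : Type u) [Field M]
    [Algebra F M] [Algebra (MvPolynomial σ F) M] [IsScalarTower F (MvPolynomial σ F) M]
    [IsFractionRing (MvPolynomial σ F) M] (μ : Ω[F⁄ℤ] →ₗ[F] F) :
    ∃ D : Derivation ℤ M M, ∀ c,
      D (algebraMap F _ c) = algebraMap F _ (μ (KaehlerDifferential.D ℤ F c)) := by
  let ν : Ω[F⁄ℤ] →ₗ[F] M := (Algebra.linearMap F _).comp μ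
  let h₀ : MvPolynomial σ F →+* DualNumber M :=
    MvPolynomial.eval₂Hom (dualNumberHom ν) fun i =>
      TrivSqZeroExt.inl (algebraMap (MvPolynomial σ F) M (MvPolynomial.X i))
  obtain ⟨D, hD⟩ := exists_derivation_extending (L := M) h₀ (by
    refine MvPolynomial.ringHom_ext (fun c => ?_) fun i => ?_
    · change (h₀ (MvPolynomial.C c)).fst = _
      rw [MvPolynomial.eval₂Hom_C, fst_dualNumberHom]
      exact IsScalarTower.algebraMap_apply _ _ _ _
    · change (h₀ (MvPolynomial.X i)).fst = _
      rw [MvPolynomial.eval₂Hom_X', TrivSqZeroExt.fst_inl])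
  refine ⟨D, fun c => ?_⟩
  rw [IsScalarTower.algebraMap_apply F (MvPolynomial σ F), hD]
  change (h₀ (MvPolynomial.C c)).snd = _
  rw [MvPolynomial.eval₂Hom_C, snd_dualNumberHom]
  rfl

variable {F : Type u} [Field F] {r : ℕ} {n : Fin r → ℕ} (a : ∀ i, Fin (n i) → F)

variable (M : Type u) [Field M] [Algebra F M] [Algebra (MvPolynomial (Σ i, Fin (n i)) F) M]

/-- The generic value `∑ⱼ a_{ij} X_{ij} ^ p`. -/
def genericValue (p : ℕ) (i : Fin r) : M :=
  ∑ j, algebraMap F M (a i j) *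
    algebraMap (MvPolynomial (Σ i, Fin (n i)) F) M (MvPolynomial.X ⟨i, j⟩) ^ p

theorem T_eq_genericValue (p : ℕ) : T p a = genericValue a (VarField F n) p := by
  funext i
  rw [T, map_sum]
  refine Finset.sum_congr rfl fun j _ => ?_
  rw [map_mul, map_pow, IsScalarTower.algebraMap_apply F (MvPolynomial (Σ i, Fin (n i)) F)]
  rfl

theorem derivation_genericValue (p : ℕ) [CharP F p] {E : Type*} [AddCommGroup E] [Module M E]
    (D : Derivation ℤ M E) (i : Fin r) :
    D (genericValue a M p i) = ∑ j, (algebraMap (MvPolynomial (Σ i, Fin (n i)) F) M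
      (MvPolynomial.X ⟨i, j⟩) ^ p) • D (algebraMap F M (a i j)) := by
  have : CharP M p := charP_of_injective_algebraMap (algebraMap F M).injective p
  rw [genericValue, map_sum]
  refine Finset.sum_congr rfl fun j _ => ?_
  rw [Derivation.leibniz, derivation_pow_char p, smul_zero, zero_add]

/-- Each dT_i is a combination of the da_{ij}; if all wedges of the latter vanished, so would the
wedge of the dT's by multilinearity. -/
theorem exists_wedge_ne_zero (p : ℕ) [CharP F p] {s : ℕ} (e : Fin s → Fin r)
    (h : LinearIndependent M fun i => KaehlerDifferential.D ℤ _ (genericValue a M p (e i))) :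
    ∃ x : Fin s → F, (∀ i, x i ∈ Set.range (a (e i))) ∧
      ExteriorAlgebra.ιMulti F s (fun i => KaehlerDifferential.D ℤ F (x i)) ≠ 0 := by
  by_contra! hcon
  refine ιMulti_ne_zero_of_linearIndependent h ?_
  refine multilinearMap_eq_zero_of_mem_span
    (ExteriorAlgebra.ιMulti M (M := Ω[M⁄ℤ]) s).toMultilinearMap
    (fun i => Set.range fun j => KaehlerDifferential.D ℤ _ (algebraMap F M (a (e i) j)))
    ?_ _ fun i => ?_
  · intro v hv
    choose j hj using hv
    have h1 := congrArg (formRes M) (hcon (fun i => a (e i) (j i)) fun i => ⟨j i, rfl⟩)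
    rw [formRes_ιMulti, map_zero] at h1
    simp only [KaehlerDifferential.map_D] at h1
    obtain rfl : _ = v := funext hj
    exact h1
  · rw [derivation_genericValue]
    exact sum_mem fun j _ => Submodule.smul_mem _ _ (Submodule.subset_span ⟨j, rfl⟩)

theorem exists_wedge_ne_zero_of_finrank {p s : ℕ} [Fact p.Prime] [CharP F p]
    (hsr : s ≤ r) (hs : Module.finrank M
      (rootsField p (genericValue a M p) {i : Fin r | (i : ℕ) < s}) = p ^ s) :
    ∃ x : Fin s → F, (∀ i, x i ∈ Set.range (a (Fin.castLE hsr i))) ∧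
      ExteriorAlgebra.ιMulti F s (fun i => KaehlerDifferential.D ℤ F (x i)) ≠ 0 := by
  have : CharP M p := charP_of_injective_algebraMap (algebraMap F M).injective p
  refine exists_wedge_ne_zero a M p (Fin.castLE hsr) ?_
  let I : Finset (Fin r) := Finset.univ.map (Fin.castLEEmb hsr)
  have hI : ((I : Finset (Fin r)) : Set (Fin r)) = {i : Fin r | (i : ℕ) < s} := by
    ext i
    simp only [I, Finset.coe_map, Finset.coe_univ, Set.image_univ, Set.mem_range]
    refine ⟨?_, fun hi => ⟨⟨i, hi⟩, rfl⟩⟩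
    rintro ⟨j, rfl⟩
    exact j.2
  have hind := linearIndependent_D_of_finrank_rootsField p (genericValue a M p) I (by
    rw [hI, hs, Finset.card_map, Finset.card_fin])
  refine hind.comp (fun i : Fin s => (⟨Fin.castLE hsr i, by simp [I]⟩ : I)) fun i j hij => ?_
  exact Fin.castLE_injective hsr (congrArg Subtype.val hij)

variable [IsScalarTower F (MvPolynomial (Σ i, Fin (n i)) F) M]
  [IsFractionRing (MvPolynomial (Σ i, Fin (n i)) F) M]

/-- Functionals dual to the chosen da's extend to derivations δ_k of M that kill the variables. The
matrix δ_k(T_l) has polynomial entries and specializes to the identity, so its determinant is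
nonzero. -/
theorem linearIndependent_D_genericValue (p : ℕ) [Fact p.Prime] [CharP F p] {m : ℕ} (u : Fin m → Σ i, Fin (n i))
    (hu : Function.Injective fun l => (u l).1)
    (h : LinearIndependent F fun l => KaehlerDifferential.D ℤ F (a (u l).1 (u l).2)) :
    LinearIndependent M fun l => KaehlerDifferential.D ℤ _ (genericValue a M p (u l).1) := by
  classical
  have hp := (Fact.out : p.Prime)
  have hdual : ∀ k, ∃ f : Ω[F⁄ℤ] →ₗ[F] F, ∀ l,
      f (KaehlerDifferential.D ℤ F (a (u l).1 (u l).2)) = if k = l then 1 else 0 := by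
    intro k
    obtain ⟨f, hf⟩ := LinearMap.exists_extend ((Finsupp.lapply k).comp h.repr)
    refine ⟨f, fun l => ?_⟩
    have h2 := LinearMap.congr_fun hf ⟨_, Submodule.subset_span ⟨l, rfl⟩⟩
    rw [LinearMap.comp_apply, Submodule.subtype_apply] at h2
    rw [h2, LinearMap.comp_apply, h.repr_eq_single l _ rfl, Finsupp.lapply_apply,
      Finsupp.single_apply]
    simp only [eq_comm]
  choose f hf using hdual
  choose δ hδ using fun k => exists_derivation_fractionField (Σ i, Fin (n i)) M (f k)
  let Q : Matrix (Fin m) (Fin m) (MvPolynomial (Σ i, Fin (n i)) F) := Matrix.of fun k l =>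
    ∑ j, MvPolynomial.C (f k (KaehlerDifferential.D ℤ F (a (u l).1 j))) *
      MvPolynomial.X ⟨(u l).1, j⟩ ^ p
  have hQ_apply : ∀ k l, Q k l =
      ∑ j, MvPolynomial.C (f k (KaehlerDifferential.D ℤ F (a (u l).1 j))) *
        MvPolynomial.X ⟨(u l).1, j⟩ ^ p := fun _ _ => rfl
  -- The chosen variables are set to 1, all others to 0. By `hu` each generic value involved
  -- contains exactly one chosen variable.
  let pt : (Σ i, Fin (n i)) → F := fun x => if ∃ l, u l = x then 1 else 0
  have hpt : ∀ l j, pt ⟨(u l).1, j⟩ = if j = (u l).2 then 1 else 0 := by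
    intro l j
    refine if_congr ⟨?_, ?_⟩ rfl rfl
    · rintro ⟨l', hl'⟩
      have h1 : (u l').1 = (u l).1 := by rw [hl']
      obtain rfl : l' = l := hu h1
      exact (eq_of_heq (Sigma.mk.inj_iff.mp hl').2).symm
    · rintro rfl
      exact ⟨l, rfl⟩
  have hQ : Q.map (MvPolynomial.eval pt) = 1 := by
    ext k l
    simp only [Matrix.map_apply, hQ_apply, map_sum, map_mul, map_pow,
      MvPolynomial.eval_C, MvPolynomial.eval_X, hpt]
    rw [Finset.sum_eq_single (u l).2]
    · simp [hf, Matrix.one_apply]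
    · intro j _ hj
      simp [hj, hp.ne_zero]
    · simp
  have hdet : Q.det ≠ 0 := by
    intro h0
    have := (MvPolynomial.eval pt).map_det Q
    rw [h0, map_zero, RingHom.mapMatrix_apply, hQ, Matrix.det_one] at this
    exact zero_ne_one this
  have hdet' : (Q.map (algebraMap _ M)).det ≠ 0 := by
    rw [← RingHom.mapMatrix_apply, ← RingHom.map_det]
    exact (map_ne_zero_iff _ (IsFractionRing.injective _ M)).mpr hdet
  rw [Fintype.linearIndependent_iff]
  intro g hg
  refine congrFun (Matrix.eq_zero_of_mulVec_eq_zero hdet' ?_)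
  funext k
  have h1 := congrArg (δ k).liftKaehlerDifferential hg
  rw [map_sum, map_zero] at h1
  rw [Pi.zero_apply, ← h1, Matrix.mulVec, dotProduct]
  refine Finset.sum_congr rfl fun l _ => ?_
  rw [map_smul, Derivation.liftKaehlerDifferential_comp_D, derivation_genericValue, smul_eq_mul, mul_comm]
  congr 1
  rw [Matrix.map_apply, hQ_apply, map_sum]
  refine Finset.sum_congr rfl fun j _ => ?_
  rw [map_mul, map_pow, hδ, smul_eq_mul, mul_comm,
    IsScalarTower.algebraMap_apply F (MvPolynomial (Σ i, Fin (n i)) F)]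
  rfl


variable {a} {p s : ℕ} [Fact p.Prime] [CharP F p]

/-- A nonzero wedge would make these s + 1 differentials independent, hence also dT_1, …, dT_s,
dT_i; but the i-th root lies in the field of the first s roots, which forces dT_i into their span.
-/
theorem wedge_mul_eq_zero_of_rootsField_eq (hs : rootsField p (genericValue a M p) Set.univ =
      rootsField p (genericValue a M p) {i : Fin r | (i : ℕ) < s}) (hsr : s ≤ r) {i : Fin r}
    (hi : s ≤ i) (l : Fin (n i)) (j : ∀ i : Fin s, Fin (n (Fin.castLE hsr i))) :
    ExteriorAlgebra.ιMulti F s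
      (fun i => KaehlerDifferential.D ℤ F (a (Fin.castLE hsr i) (j i))) * dE (a i l) = 0 := by
  have : CharP M p := charP_of_injective_algebraMap (algebraMap F M).injective p
  by_contra hne
  let u : Fin (s + 1) → Σ i, Fin (n i) :=
    Fin.snoc (α := fun _ => Σ i, Fin (n i)) (fun i => ⟨Fin.castLE hsr i, j i⟩) ⟨i, l⟩
  have hu1 : ∀ k : Fin s, u k.castSucc = ⟨Fin.castLE hsr k, j k⟩ := fun k => by simp [u]
  have hu2 : u (Fin.last s) = ⟨i, l⟩ := by simp [u]
  have hind : LinearIndependent F fun k => KaehlerDifferential.D ℤ F (a (u k).1 (u k).2) := by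
    by_contra hdep
    apply hne
    have h1 := (ExteriorAlgebra.ιMulti F (s + 1)).map_linearDependent _ hdep
    rw [ιMulti_snoc] at h1
    rw [hu2] at h1
    refine Eq.trans ?_ h1
    congr 3
    funext k
    rw [hu1]
  have hinj : Function.Injective fun k => (u k).1 := by
    intro k k'
    refine Fin.lastCases ?_ (fun k => ?_) k <;> refine Fin.lastCases ?_ (fun k' => ?_) k'
    · simp
    · simp only [hu1, hu2]
      rintro rfl
      exact absurd hi (not_le.mpr k'.2)
    · simp only [hu1, hu2]
      rintro rfl
      exact absurd hi (not_le.mpr k.2)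
    · simp only [hu1]
      intro h
      rw [Fin.castLE_injective hsr h]
  have hT := linearIndependent_D_genericValue a M p u hinj hind
  refine hT.notMem_span_image (s := Set.range Fin.castSucc) (x := Fin.last s) ?_ ?_
  · rintro ⟨k, hk⟩
    exact (Fin.castSucc_lt_last k).ne hk
  · obtain ⟨y, hy⟩ := IsAlgClosed.exists_pow_nat_eq
      (algebraMap M (AlgebraicClosure M) (genericValue a M p i))
      (Fact.out : p.Prime).pos
    have hmem : y ∈ rootsField p (genericValue a M p) Set.univ :=
      IntermediateField.subset_adjoin _ _ ⟨i, Set.mem_univ i, hy⟩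
    rw [hs] at hmem
    have := D_mem_span_of_mem_rootsField p (genericValue a M p) hmem hy
    simp only [hu2]
    refine Submodule.span_mono ?_ this
    rintro _ ⟨k, hk, rfl⟩
    refine ⟨Fin.castSucc ⟨k, hk⟩, ⟨_, rfl⟩, ?_⟩
    simp only [hu1]
    rfl

theorem IsFormOrdering.exists_wedge_ne_zero (hs : IsFormOrdering p a s) (hsr : s ≤ r) :
    ∃ x : Fin s → F, (∀ i, x i ∈ Set.range (a (Fin.castLE hsr i))) ∧
      ExteriorAlgebra.ιMulti F s (fun i => KaehlerDifferential.D ℤ F (x i)) ≠ 0 := by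
  refine exists_wedge_ne_zero_of_finrank a (VarField F n) hsr ?_
  have h := hs.1
  rw [hs.2, rootField, T_eq_genericValue] at h
  exact h

theorem IsFormOrdering.wedge_mul_eq_zero (hs : IsFormOrdering p a s) (hsr : s ≤ r) {i : Fin r}
    (hi : s ≤ i) (l : Fin (n i)) (j : ∀ i : Fin s, Fin (n (Fin.castLE hsr i))) :
    ExteriorAlgebra.ιMulti F s
      (fun i => KaehlerDifferential.D ℤ F (a (Fin.castLE hsr i) (j i))) * dE (a i l) = 0 := by
  refine wedge_mul_eq_zero_of_rootsField_eq (VarField F n) ?_ hsr hi l j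
  have h := hs.2
  rw [rootField, rootField, T_eq_genericValue] at h
  exact h

end GenericValues

/-! ### Annihilators depend only on spans of differentials -/

section Annihilators

variable {F : Type u} [Field F] {s : ℕ}

/-- `ω` is annihilated by all `d x₁ ∧ … ∧ d xₛ` with `xᵢ ∈ Sᵢ`. -/
def WedgeAnnihilated (S : Fin s → Set F) (ω : ExteriorAlgebra F (Ω[F⁄ℤ])) : Prop :=
  ∀ x : Fin s → F, (∀ i, x i ∈ S i) →
    ExteriorAlgebra.ιMulti F s (fun i => KaehlerDifferential.D ℤ F (x i)) * ω = 0

/-- The differentials of elements of `S` lie in the span of those of elements of `S'`. -/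
def DiffSubset (S S' : Set F) : Prop :=
  ∀ x ∈ S, KaehlerDifferential.D ℤ F x ∈ Submodule.span F (KaehlerDifferential.D ℤ F '' S')

theorem DiffSubset.of_subset {S S' : Set F} (h : S ⊆ S') : DiffSubset S S' :=
  fun x hx => Submodule.subset_span ⟨x, h hx, rfl⟩

theorem WedgeAnnihilated.mono {S S' : Fin s → Set F} (h : ∀ i, DiffSubset (S i) (S' i))
    {ω : ExteriorAlgebra F (Ω[F⁄ℤ])} (hω : WedgeAnnihilated S' ω) : WedgeAnnihilated S ω := by
  intro x hx
  refine multilinearMap_eq_zero_of_mem_span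
    ((LinearMap.mulRight F ω).compMultilinearMap
      (ExteriorAlgebra.ιMulti F (M := Ω[F⁄ℤ]) s).toMultilinearMap)
    (fun i => KaehlerDifferential.D ℤ F '' S' i) ?_ _ fun i => h i _ (hx i)
  intro v hv
  choose y hy hyv using hv
  obtain rfl : _ = v := funext hyv
  exact hω y hy

theorem wedgeAnnihilated_congr {S S' : Fin s → Set F} (h : ∀ i, DiffSubset (S i) (S' i))
    (h' : ∀ i, DiffSubset (S' i) (S i)) (ω : ExteriorAlgebra F (Ω[F⁄ℤ])) :
    WedgeAnnihilated S ω ↔ WedgeAnnihilated S' ω :=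
  ⟨WedgeAnnihilated.mono h', WedgeAnnihilated.mono h⟩

theorem mem_annOmega_dWedgeSet_iff {m : ℕ} (S : Fin s → Set F) (ω : DiffForm m F) :
    ω ∈ annOmega m (dWedgeSet S) ↔ WedgeAnnihilated S (ω : ExteriorAlgebra F (Ω[F⁄ℤ])) := by
  constructor
  · intro h x hx
    rw [ιMulti_mul_eq_zero_comm]
    exact h _ ⟨x, hx, rfl⟩
  · rintro h _ ⟨x, hx, rfl⟩
    exact (ιMulti_mul_eq_zero_comm _ _).mp (h x hx)

/-- Annihilation of 1 encodes vanishing of all the wedges, so nonvanishing too can be transferred by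
`WedgeAnnihilated.mono`. -/
theorem exists_ne_zero_of_not_wedgeAnnihilated {S : Fin s → Set F}
    (h : ¬ WedgeAnnihilated S 1) : ∃ ω ∈ dWedgeSet S, ω ≠ 0 := by
  rw [WedgeAnnihilated] at h
  push Not at h
  obtain ⟨x, hx, hne⟩ := h
  refine ⟨dWedge x, ⟨x, hx, rfl⟩, fun h0 => hne ?_⟩
  rw [mul_one]
  exact congrArg Subtype.val h0

/-- The elements with differential in a fixed subspace form a subfield containing F^p. -/
theorem DiffSubset.of_mem_adjoin (p : ℕ) [Fact p.Prime] [CharP F p] {S : Set F}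
    {E : IntermediateField (powField p F) F} (hE : E = powAdjoin p S) :
    DiffSubset (E : Set F) S := by
  let D : IntermediateField (powField p F) F := (diffSubfield
    (Submodule.span F (KaehlerDifferential.D ℤ F '' S))).toIntermediateField (by
      rintro ⟨_, y, rfl⟩
      exact pow_mem_diffSubfield p _ y)
  have hle : E ≤ D := by
    rw [hE]
    exact IntermediateField.adjoin_le_iff.mpr fun x hx => Submodule.subset_span ⟨x, hx, rfl⟩
  exact fun x hx => hle hx

theorem PForm.coeff_oneCons_zero {n : ℕ} (a : Fin n → F) :
    (PForm.oneCons a).coeff (0 : Fin (n + 1)) = 1 := rfl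

theorem diffSubset_range_coeff_oneCons {n : ℕ} (a : Fin n → F) :
    DiffSubset (Set.range (PForm.oneCons a).coeff) (Set.range a) := by
  rintro _ ⟨(i : Fin (n + 1)), rfl⟩
  refine Fin.cases ?_ (fun j => ?_) i
  · rw [PForm.coeff_oneCons_zero, Derivation.map_one_eq_zero]
    exact zero_mem _
  · exact Submodule.subset_span ⟨_, ⟨j, rfl⟩, rfl⟩

theorem range_subset_range_coeff_oneCons {n : ℕ} (a : Fin n → F) :
    Set.range a ⊆ Set.range (PForm.oneCons a).coeff := by
  rintro _ ⟨j, rfl⟩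
  exact ⟨(j.succ : Fin (n + 1)), rfl⟩

theorem nuKernel_eq (p m : ℕ) (K : Type u) [Field K] [Algebra F K] :
    nuKernel p m F K = {χ | χ ∈ nu p m F ∧ χ ∈ omegaKernel m F K} := rfl

theorem annNu_eq (p m : ℕ) (U : Set (DiffForm s F)) :
    annNu p m U = {χ | χ ∈ nu p m F ∧ χ ∈ annOmega m U} := rfl

variable (p : ℕ) [Fact p.Prime] [CharP F p]

theorem PForm.normField_eq_powAdjoin (φ : PForm F) {i₀ : Fin φ.dim} (hi₀ : φ.coeff i₀ = 1) :
    φ.normField p = powAdjoin p (Set.range φ.coeff) := by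
  refine le_antisymm (φ.normField_le p fun i => IntermediateField.subset_adjoin _ _ ⟨i, rfl⟩) ?_
  refine IntermediateField.adjoin_le_iff.mpr ?_
  rintro _ ⟨i, rfl⟩
  exact φ.coeff_mem_normField p hi₀ i

theorem diffSubset_normField_range {n : ℕ} (a : Fin n → F) :
    DiffSubset ((PForm.oneCons a).normField p : Set F) (Set.range (PForm.oneCons a).coeff) :=
  DiffSubset.of_mem_adjoin p (PForm.normField_eq_powAdjoin p _ (PForm.coeff_oneCons_zero a))

theorem diffSubset_range_normField {n : ℕ} (a : Fin n → F) :
    DiffSubset (Set.range (PForm.oneCons a).coeff) ((PForm.oneCons a).normField p : Set F) := by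
  refine DiffSubset.of_subset ?_
  rintro _ ⟨i, rfl⟩
  exact PForm.coeff_mem_normField p _ (PForm.coeff_oneCons_zero a) i

end Annihilators

/-! ### Kernels as annihilators of norm field differentials -/

section Kernels

variable {p : ℕ} [Fact p.Prime] {F : Type u} [Field F] [CharP F p] {r s : ℕ} {n : Fin r → ℕ}
  {a : ∀ i, Fin (n i) → F}

/-- The forms `⟨1, a_{i1}, …⟩` as a sequence, continued by `⟨1⟩`. -/
def formSeq (a : ∀ i, Fin (n i) → F) (i : ℕ) : PForm F :=
  if h : i < r then PForm.oneCons (a ⟨i, h⟩) else PForm.oneCons (n := 0) Fin.elim0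

theorem formSeq_coe (i : Fin r) : formSeq a i = PForm.oneCons (a i) := by
  rw [formSeq, dif_pos i.2]

theorem exists_coeff_formSeq_eq_one (i : ℕ) : ∃ i₀, (formSeq a i).coeff i₀ = 1 := by
  by_cases h : i < r
  · rw [formSeq, dif_pos h]
    exact ⟨(0 : Fin (_ + 1)), rfl⟩
  · rw [formSeq, dif_neg h]
    exact ⟨(0 : Fin (_ + 1)), rfl⟩

theorem forall_coeffWedge_iff (hsr : s ≤ r) (x : ExteriorAlgebra F (Ω[F⁄ℤ])) :
    (∀ j, coeffWedge (formSeq a) s j * x = 0) ↔ WedgeAnnihilated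
      (fun i : Fin s => Set.range (PForm.oneCons (a (Fin.castLE hsr i))).coeff) x := by
  have h : (fun i : Fin s => Set.range (PForm.oneCons (a (Fin.castLE hsr i))).coeff) =
      fun i : Fin s => Set.range (formSeq a i).coeff := by
    funext i
    rw [← formSeq_coe]
    rfl
  rw [h]
  constructor
  · intro H y hy
    choose j hj using hy
    obtain rfl : _ = y := funext hj
    exact H j
  · exact fun H j => H _ fun i => ⟨j i, rfl⟩

theorem IsFormOrdering.not_wedgeAnnihilated_one (hs : IsFormOrdering p a s) (hsr : s ≤ r) :
    ¬ WedgeAnnihilated (fun i : Fin s => Set.range (a (Fin.castLE hsr i))) 1 := by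
  obtain ⟨x, hx, hne⟩ := hs.exists_wedge_ne_zero hsr
  intro h
  exact hne (by simpa using h x hx)

/-- Stated for every `t` between `s` and `r` in order to cover both fields of the theorem, t = s and
t = r. -/
theorem IsFormOrdering.formRes_eq_zero_iff (hs : IsFormOrdering p a s) (hsr : s ≤ r) {t : ℕ}
    (hst : s ≤ t) (htr : t ≤ r) (x : ExteriorAlgebra F (Ω[F⁄ℤ])) :
    formRes (iterFunctionField p t fun i => PForm.oneCons (a (Fin.castLE htr i))).carrier x = 0 ↔
      WedgeAnnihilated
        (fun i : Fin s => ((PForm.oneCons (a (Fin.castLE hsr i))).normField p : Set F)) x := by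
  have hseq : (fun i : Fin t => PForm.oneCons (a (Fin.castLE htr i))) =
      fun i : Fin t => formSeq a i := by
    funext i
    rw [← formSeq_coe]
    rfl
  rw [hseq, formRes_iterFunctionField_eq_zero_iff_of_le _ exists_coeff_formSeq_eq_one hst,
    forall_coeffWedge_iff hsr]
  · exact wedgeAnnihilated_congr (fun i => diffSubset_range_normField p _)
      (fun i => diffSubset_normField_range p _) x
  · by_contra! h
    refine hs.not_wedgeAnnihilated_one hsr (WedgeAnnihilated.mono (fun i => ?_)
      ((forall_coeffWedge_iff hsr 1).mp fun j => by rw [h j, zero_mul]))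
    exact DiffSubset.of_subset (range_subset_range_coeff_oneCons _)
  · intro i hi hit j l
    have hir := hit.trans_le htr
    refine (forall_coeffWedge_iff hsr _).mpr ?_ j
    refine WedgeAnnihilated.mono (fun i => diffSubset_range_coeff_oneCons _) ?_
    intro y hy
    choose j' hj' using hy
    obtain rfl : _ = y := funext hj'
    have key : ∀ l : Fin (PForm.oneCons (a ⟨i, hir⟩)).dim,
        ExteriorAlgebra.ιMulti F s
          (fun i => KaehlerDifferential.D ℤ F (a (Fin.castLE hsr i) (j' i))) *
          dE ((PForm.oneCons (a ⟨i, hir⟩)).coeff l) = 0 := by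
      intro (l : Fin (_ + 1))
      refine Fin.cases ?_ (fun l => ?_) l
      · rw [PForm.coeff_oneCons_zero, dE, Derivation.map_one_eq_zero, map_zero, mul_zero]
      · exact hs.wedge_mul_eq_zero hsr hi l j'
    rw [← formSeq_coe (a := a) ⟨i, hir⟩] at key
    exact key l

theorem IsFormOrdering.omegaKernel_eq (hs : IsFormOrdering p a s) (hsr : s ≤ r) {t : ℕ}
    (hst : s ≤ t) (htr : t ≤ r) (m : ℕ) :
    omegaKernel m F
        (iterFunctionField p t fun i => PForm.oneCons (a (Fin.castLE htr i))).carrier =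
      annOmega m (dWedgeSet fun i : Fin s =>
        ((PForm.oneCons (a (Fin.castLE hsr i))).normField p : Set F)) := by
  ext ω
  rw [mem_omegaKernel_iff, mem_annOmega_dWedgeSet_iff, hs.formRes_eq_zero_iff hsr hst htr]

end Kernels

end PFormKernels

end

theorem theorem4p5 (p : ℕ) [Fact p.Prime] (F : Type u) [Field F] [CharP F p]
    -- the forms `φ_i = ⟨1, a_{i1}, …, a_{i n_i}⟩_p`, `i = 1, …, r`
    (r : ℕ) (n : Fin r → ℕ) (a : ∀ i, Fin (n i) → F)
    (φ : Fin r → PFormKernels.PForm F) (hφ : ∀ i, φ i = PFormKernels.PForm.oneCons (a i))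
    (k : Fin r → ℕ) (hk : ∀ i, PFormKernels.IsCoeffOrdering p (a i) (k i))
    (s : ℕ) (hsr : s ≤ r) (hs : PFormKernels.IsFormOrdering p a s)
    -- the set `d{a_{11}, …, a_{1 k_1}} ∧ … ∧ d{a_{s1}, …, a_{s k_s}}`
    (A : Set (PFormKernels.DiffForm s F))
    (hA : A = PFormKernels.dWedgeSet fun i : Fin s =>
      {x | ∃ j : Fin (n (Fin.castLE hsr i)), (j : ℕ) < k (Fin.castLE hsr i) ∧ x = a (Fin.castLE hsr i) j})
    -- the set `d N_F(φ_1) ∧ … ∧ d N_F(φ_s)`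
    (N : Set (PFormKernels.DiffForm s F))
    (hN : N = PFormKernels.dWedgeSet fun i : Fin s =>
      ((φ (Fin.castLE hsr i)).normField p : Set F))
    -- the fields `F(φ_1, …, φ_r)` and `F(φ_1, …, φ_s)`
    (E E' : PFormKernels.FieldExt p F)
    (hE : E = PFormKernels.iterFunctionField p r φ)
    (hE' : E' = PFormKernels.iterFunctionField p s fun i => φ (Fin.castLE hsr i)) :
    (∃ ω ∈ A, ω ≠ 0) ∧
    (∃ ω ∈ N, ω ≠ 0) ∧
    (∀ m : ℕ,
      PFormKernels.omegaKernel m F E.carrier = PFormKernels.omegaKernel m F E'.carrier ∧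
      PFormKernels.omegaKernel m F E'.carrier = PFormKernels.annOmega m A ∧
      PFormKernels.annOmega m A = PFormKernels.annOmega m N ∧
      PFormKernels.nuKernel p m F E.carrier = PFormKernels.nuKernel p m F E'.carrier ∧
      PFormKernels.nuKernel p m F E'.carrier = PFormKernels.annNu p m A ∧
      PFormKernels.annNu p m A = PFormKernels.annNu p m N) ∧
    -- the kernels depend only on the norm fields of `φ_1, …, φ_s`
    (∀ (r₂ : ℕ) (n₂ : Fin r₂ → ℕ) (b : ∀ i, Fin (n₂ i) → F) (hsr₂ : s ≤ r₂),
      PFormKernels.IsFormOrdering p b s →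
      (∀ i : Fin s, (PFormKernels.PForm.oneCons (b (Fin.castLE hsr₂ i))).normField p =
        (φ (Fin.castLE hsr i)).normField p) →
      ∀ E₂ : PFormKernels.FieldExt p F,
        E₂ = PFormKernels.iterFunctionField p r₂ (fun i => PFormKernels.PForm.oneCons (b i)) →
        ∀ m : ℕ,
          PFormKernels.omegaKernel m F E₂.carrier = PFormKernels.omegaKernel m F E.carrier ∧
          PFormKernels.nuKernel p m F E₂.carrier = PFormKernels.nuKernel p m F E.carrier) := by
  open PFormKernels in
  obtain rfl : φ = fun i => PForm.oneCons (a i) := funext hφ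
  have hEm : ∀ m, omegaKernel m F E.carrier = annOmega m N := fun m => by
    rw [hE, hN]
    exact hs.omegaKernel_eq hsr hsr le_rfl m
  have hEm' : ∀ m, omegaKernel m F E'.carrier = annOmega m N := fun m => by
    rw [hE', hN]
    exact hs.omegaKernel_eq hsr le_rfl hsr m
  have hNA : ∀ i : Fin s, DiffSubset
      ((PForm.oneCons (a (Fin.castLE hsr i))).normField p : Set F)
      {x | ∃ j : Fin (n (Fin.castLE hsr i)), (j : ℕ) < k (Fin.castLE hsr i) ∧
        x = a (Fin.castLE hsr i) j} := fun i =>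
    DiffSubset.of_mem_adjoin p (hk (Fin.castLE hsr i)).2.2
  have hAN' : ∀ i : Fin s, DiffSubset
      {x | ∃ j : Fin (n (Fin.castLE hsr i)), (j : ℕ) < k (Fin.castLE hsr i) ∧
        x = a (Fin.castLE hsr i) j}
      ((PForm.oneCons (a (Fin.castLE hsr i))).normField p : Set F) := by
    refine fun i => DiffSubset.of_subset ?_
    rintro _ ⟨j, -, rfl⟩
    -- Coefficient 0 of the form is the leading 1, so a_j is the coefficient with index j + 1.
    exact PForm.coeff_mem_normField p _ (PForm.coeff_oneCons_zero _) (Fin.succ j : Fin (_ + 1))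
  have haN : ∀ i : Fin s, DiffSubset (Set.range (a (Fin.castLE hsr i)))
      ((PForm.oneCons (a (Fin.castLE hsr i))).normField p : Set F) := by
    refine fun i => DiffSubset.of_subset ?_
    rintro _ ⟨j, rfl⟩
    exact PForm.coeff_mem_normField p _ (PForm.coeff_oneCons_zero _) (Fin.succ j : Fin (_ + 1))
  have hAN : ∀ m, annOmega m A = annOmega m N := fun m => by
    ext ω
    rw [hA, hN, mem_annOmega_dWedgeSet_iff, mem_annOmega_dWedgeSet_iff]
    exact wedgeAnnihilated_congr hAN' hNA _
  have hN1 : ¬ WedgeAnnihilated (fun i : Fin s =>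
      ((PForm.oneCons (a (Fin.castLE hsr i))).normField p : Set F)) 1 :=
    fun h => hs.not_wedgeAnnihilated_one hsr (h.mono haN)
  refine ⟨?_, ?_, fun m => ?_, ?_⟩
  · rw [hA]
    exact exists_ne_zero_of_not_wedgeAnnihilated fun h => hN1 (h.mono hNA)
  · rw [hN]
    exact exists_ne_zero_of_not_wedgeAnnihilated hN1
  · simp only [nuKernel_eq, annNu_eq, hEm, hEm', hAN, and_self]
  · intro r₂ n₂ b hsr₂ hs₂ hb E₂ hE₂ m
    -- The second family has its own norm field annihilator as kernel, and by `hb` this is the same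
    -- set.
    have hE₂m : omegaKernel m F E₂.carrier = annOmega m N := by
      rw [hE₂, hN]
      simp only [← hb]
      exact hs₂.omegaKernel_eq hsr₂ hsr₂ le_rfl m
    simp only [nuKernel_eq, hEm, hE₂m, and_self]
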